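/- Let $\mathbb C_{1/2}^+=\{s\in\mathbb C:\operatorname{Re}s>1/2\}$. Let $H^2(\mathbb C_{1/2}^+)$ be the space of holomorphic functions $f$ on $\mathbb C_{1/2}^+$ with $\sup_{\sigma>1/2}\int_{-\infty}^{\infty}|f(\sigma+it)|^2\,dt<\infty$, and let $\mathscr H^2$ be the space of Dirichlet series $F(s)=\sum_{n\ge 1}a_n n^{-s}$ with $\sum_{n\ge1}|a_n|^2<\infty$, viewed as holomorphic functions on $\mathbb C_{1/2}^+$. Let $S=(s_j)$, $s_j=\sigma_j+it_j$, be a bounded (finite or infinite) sequence of not necessarily distinct points of $\mathbb C_{1/2}^+$ that satisfies the Blaschke condition $\sum_j(\sigma_j-1/2)<\infty$, and let $$B(s)=\prod_j\frac{s-s_j}{s-(1-\overline{s_j})},\qquad s\in\mathbb C_{1/2}^+,$$ be its Blaschke product (which converges). Then for every $f\in H^2(\mathbb C_{1/2}^+)$ there is an $F\in\mathscr H^2$ that agrees with $f$ on $S$, in the sense that $B$ divides $f-F$: there is a holomorphic function $g$ on $\mathbb C_{1/2}^+$ such that $f(s)-F(s)=B(s)g(s)$ for all $s\in\mathbb C_{1/2}^+$.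 -/

import Mathlib

open Complex MeasureTheory
open scoped ENNReal

/-- The open half-plane `Re s > 1/2`. -/
def halfPlane : Set ℂ := {s : ℂ | 1 / 2 < s.re}

/-- The square of the norm of `H²(Re s > 1/2)`: the supremum over `σ > 1/2` of
`∫ |f(σ + it)|² dt`, with values in `[0, ∞]`. -/
noncomputable def hardyNormSq (f : ℂ → ℂ) : ℝ≥0∞ :=
  ⨆ (σ : ℝ) (_ : 1 / 2 < σ), ∫⁻ t : ℝ, ‖f ((σ : ℂ) + (t : ℂ) * I)‖ₑ ^ 2

/-- `f` belongs to the Hardy space `H²` of the half-plane `Re s > 1/2`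
(values of `f` outside the half-plane play no role). -/
def MemHardy2 (f : ℂ → ℂ) : Prop :=
  DifferentiableOn ℂ f halfPlane ∧ hardyNormSq f < ∞

/-- `F` belongs to `ℋ²`: on the half-plane `Re s > 1/2` it is the sum of a Dirichlet series
`∑_{n ≥ 1} a_n n^{-s}` with `∑ |a_n|² < ∞`. (The term of index `0` of an `LSeries` is `0`,
so the value `a 0` plays no role.) -/
def MemDirichletH2 (F : ℂ → ℂ) : Prop :=
  ∃ a : ℕ → ℂ, Summable (fun n => ‖a n‖ ^ 2) ∧ ∀ s ∈ halfPlane, LSeriesHasSum a s (F s)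

/-- A bounded Blaschke sequence in `Re s > 1/2`: a bounded family of not necessarily distinct
points `s_j = σ_j + i t_j` of the half-plane with `∑_j (σ_j - 1/2) < ∞`. -/
structure IsBoundedBlaschke {ι : Type*} (S : ι → ℂ) : Prop where
  mem : ∀ j, S j ∈ halfPlane
  bounded : Bornology.IsBounded (Set.range S)
  summable : Summable (fun j => (S j).re - 1 / 2)

/-- The Blaschke factor of `Re s > 1/2` with zero `w` and pole at the reflected point
`1 - conj w`. -/
noncomputable def blaschkeFactor (w s : ℂ) : ℂ :=
  (s - w) / (s - (1 - (starRingEnd ℂ) w))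

/-- The Blaschke product with zeros `S j`, counted with multiplicity. For bounded sequences no
unimodular convergence factors are needed; see `multipliable_blaschkeFactor`. -/
noncomputable def blaschkeProduct {ι : Type*} (S : ι → ℂ) (s : ℂ) : ℂ :=
  ∏' j, blaschkeFactor (S j) s

/-- `B` divides `h` among the holomorphic functions on `Re s > 1/2`. -/
def DividesOnHalfPlane (B h : ℂ → ℂ) : Prop :=
  ∃ g : ℂ → ℂ, DifferentiableOn ℂ g halfPlane ∧ ∀ s ∈ halfPlane, h s = B s * g s

/-- The Blaschke product converges (unconditionally) at every point of the half-plane. -/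
theorem multipliable_blaschkeFactor {ι : Type*} {S : ι → ℂ} (hS : IsBoundedBlaschke S)
    {s : ℂ} (hs : s ∈ halfPlane) : Multipliable (fun j => blaschkeFactor (S j) s) := by
  have hs' : 0 < s.re - 1 / 2 := sub_pos.mpr hs
  have key : ∀ j, ‖blaschkeFactor (S j) s - 1‖
      ≤ (2 / (s.re - 1 / 2)) * ((S j).re - 1 / 2) := by
    intro j
    have hj : 0 < (S j).re - 1 / 2 := sub_pos.mpr (hS.mem j)
    have hre : (s - (1 - (starRingEnd ℂ) (S j))).re = (s.re - 1 / 2) + ((S j).re - 1 / 2) := by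
      simp; ring
    have hle : s.re - 1 / 2 ≤ ‖s - (1 - (starRingEnd ℂ) (S j))‖ := by
      refine le_trans ?_ (Complex.re_le_norm _)
      rw [hre]; linarith
    have hne : s - (1 - (starRingEnd ℂ) (S j)) ≠ 0 := norm_pos_iff.mp (hs'.trans_le hle)
    have hnum : (s - S j) - (s - (1 - (starRingEnd ℂ) (S j)))
        = ((-(2 * ((S j).re - 1 / 2)) : ℝ) : ℂ) := by
      apply Complex.ext <;> simp
      ring
    have heq : blaschkeFactor (S j) s - 1
        = ((-(2 * ((S j).re - 1 / 2)) : ℝ) : ℂ) / (s - (1 - (starRingEnd ℂ) (S j))) := by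
      rw [blaschkeFactor, div_sub_one hne, hnum]
    rw [heq, norm_div, Complex.norm_real, norm_neg, Real.norm_of_nonneg (by positivity)]
    calc 2 * ((S j).re - 1 / 2) / ‖s - (1 - (starRingEnd ℂ) (S j))‖
        ≤ 2 * ((S j).re - 1 / 2) / (s.re - 1 / 2) := by gcongr
      _ = _ := by ring
  have hsum : Summable (fun j => ‖blaschkeFactor (S j) s - 1‖) :=
    Summable.of_nonneg_of_le (fun _ => norm_nonneg _) key (hS.summable.mul_left _)
  simpa using multipliable_one_add_of_summable hsum

/-! Translate by 1/2, so that the points a_j lie in Re z > 0, and take finitely many of them, with P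
= ∏ (z - a_j). The functionals f ↦ (2πi)⁻¹ ∮ f q / P, q a polynomial, encode the values and
derivatives of f at the zeros of P, and all of them vanish at h exactly when P divides h
(`exists_eq_rootPoly_mul`, `contourFunctional_eq_zero_of_dvd`). Applied to exp(-zx), such a
functional gives an exponential polynomial u(x). Its size on H² is at most a constant times the norm
of u in L²(0,∞), as the Laplace transform picture predicts
(`norm_contourFunctional_sq_le_of_hardy`). On a Dirichlet series it pairs the coefficients with the
samples n^(-1/2) u(log n) (`contourFunctional_lSeries`). By Hahn-Banach and Riesz, a Dirichlet
series with the same functionals as f exists, with controlled norm, once ‖u‖² ≤ C ∑ |u(log n)|² / n.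

The constant C must not depend on the finite set. This rests on the Bernstein inequality ‖u'‖ ≤ R
‖u‖ with R = M + 2 ∑ Re a_j and |a_j| ≤ M (`expSumNormSq_X_mul_le`), where boundedness and the
Blaschke condition enter. For large x the points log n are dense enough for the weighted samples to
act as a Riemann sum; on the remaining bounded interval the geometric growth of derivatives makes
Lagrange interpolation at log 1, ..., log (K+1) accurate (`exists_integral_norm_sq_le_tsum`).

The Bernstein inequality and the bound on H² are proved by adding one point at a time. Each added
point a splits off one dimension orthogonally: on the side of u by `expSumNormSq_cons`, on the side
of H² by division by (z - a)/(z + conj a) (`HalfPlaneDecay.exists_blaschke_quotient`).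

Finally, weak-* compactness gives one Dirichlet series serving all finite sets
(`exists_dirichlet_interpolant`), and divisibility by every finite product of the z - a_j gives
divisibility by B, because the tails of B are holomorphic and nonzero at the zeros taken out
(`dividesOnHalfPlane_blaschkeProduct`). -/

/-! ### Contour functionals and divisibility by a finite product -/

/-- The monic polynomial with roots `s`. -/
noncomputable def rootPoly (s : Multiset ℂ) : Polynomial ℂ :=
  (s.map fun a => Polynomial.X - Polynomial.C a).prod

/-- The functional `f ↦ (2πi)⁻¹ ∮ f q / ∏ (z - a)` over a circle. -/
noncomputable def contourFunctional (c : ℂ) (r : ℝ) (s : Multiset ℂ) (q : Polynomial ℂ)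
    (f : ℂ → ℂ) : ℂ :=
  (2 * Real.pi * I)⁻¹ * ∮ z in C(c, r), f z * (q.eval z / (rootPoly s).eval z)

/-- The inverse Laplace transform of `q / ∏ (z - a)`, up to sign. -/
noncomputable def expSum (c : ℂ) (r : ℝ) (s : Multiset ℂ) (q : Polynomial ℂ) (x : ℝ) : ℂ :=
  contourFunctional c r s q fun z => exp (-(z * x))

@[simp] lemma rootPoly_zero : rootPoly 0 = 1 := by simp [rootPoly]

lemma rootPoly_add (s t : Multiset ℂ) : rootPoly (s + t) = rootPoly s * rootPoly t := by
  simp [rootPoly]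

lemma eval_rootPoly (s : Multiset ℂ) (z : ℂ) :
    (rootPoly s).eval z = (s.map fun a => z - a).prod := by
  simp [rootPoly, Polynomial.eval_multiset_prod]

lemma eval_rootPoly_ne_zero {s : Multiset ℂ} {z : ℂ} (h : z ∉ s) : (rootPoly s).eval z ≠ 0 := by
  rw [eval_rootPoly, Ne, Multiset.prod_eq_zero_iff]
  simp only [Multiset.mem_map, not_exists, not_and]
  intro a ha h0
  exact h ((sub_eq_zero.mp h0) ▸ ha)

lemma eval_rootPoly_ne_zero_of_mem_sphere {s : Multiset ℂ} {c z : ℂ} {r : ℝ}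
    (hs : ∀ a ∈ s, a ∈ Metric.ball c r) (hz : z ∈ Metric.sphere c r) :
    (rootPoly s).eval z ≠ 0 :=
  eval_rootPoly_ne_zero fun h => by
    have := hs z h
    simp only [Metric.mem_ball, Metric.mem_sphere] at *
    linarith

section Functional

variable {c : ℂ} {r : ℝ} {s : Multiset ℂ}

lemma continuousOn_ratio (hs : ∀ a ∈ s, a ∈ Metric.ball c r) (q : Polynomial ℂ) :
    ContinuousOn (fun z => q.eval z / (rootPoly s).eval z) (Metric.sphere c r) :=
  q.continuous.continuousOn.div (rootPoly s).continuous.continuousOn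
    fun _ hz => eval_rootPoly_ne_zero_of_mem_sphere hs hz

lemma contourFunctional_add_left (hr : 0 < r) (hs : ∀ a ∈ s, a ∈ Metric.ball c r)
    (p q : Polynomial ℂ) {f : ℂ → ℂ} (hf : ContinuousOn f (Metric.sphere c r)) :
    contourFunctional c r s (p + q) f
      = contourFunctional c r s p f + contourFunctional c r s q f := by
  unfold contourFunctional
  rw [← mul_add, ← circleIntegral.integral_add]
  · congr 2; ext z; simp; ring
  · exact (hf.mul (continuousOn_ratio hs p)).circleIntegrable hr.le
  · exact (hf.mul (continuousOn_ratio hs q)).circleIntegrable hr.le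

lemma contourFunctional_add_right (hr : 0 < r) (hs : ∀ a ∈ s, a ∈ Metric.ball c r)
    (q : Polynomial ℂ) {f g : ℂ → ℂ} (hf : ContinuousOn f (Metric.sphere c r))
    (hg : ContinuousOn g (Metric.sphere c r)) :
    contourFunctional c r s q (fun z => f z + g z)
      = contourFunctional c r s q f + contourFunctional c r s q g := by
  unfold contourFunctional
  rw [← mul_add, ← circleIntegral.integral_add]
  · congr 2; ext z; ring
  · exact (hf.mul (continuousOn_ratio hs q)).circleIntegrable hr.le
  · exact (hg.mul (continuousOn_ratio hs q)).circleIntegrable hr.le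

lemma contourFunctional_C_mul (b : ℂ) (q : Polynomial ℂ) (f : ℂ → ℂ) :
    contourFunctional c r s (Polynomial.C b * q) f = b * contourFunctional c r s q f := by
  unfold contourFunctional
  rw [mul_left_comm, ← circleIntegral.integral_const_mul b]
  congr 2; ext z; simp; ring

lemma contourFunctional_const_mul (b : ℂ) (q : Polynomial ℂ) (f : ℂ → ℂ) :
    contourFunctional c r s q (fun z => b * f z) = b * contourFunctional c r s q f := by
  unfold contourFunctional
  rw [mul_left_comm, ← circleIntegral.integral_const_mul b]
  congr 2; ext z; ring

lemma contourFunctional_neg (q : Polynomial ℂ) (f : ℂ → ℂ) :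
    contourFunctional c r s (-q) f = -contourFunctional c r s q f := by
  have := contourFunctional_C_mul (c := c) (r := r) (s := s) (-1) q f
  simpa using this

lemma contourFunctional_mul_left (p q : Polynomial ℂ) (f : ℂ → ℂ) :
    contourFunctional c r s (p * q) f = contourFunctional c r s q fun z => p.eval z * f z := by
  unfold contourFunctional
  congr 2; ext z; simp; ring

lemma contourFunctional_congr (hr : 0 < r) (q : Polynomial ℂ) {f g : ℂ → ℂ}
    (h : Set.EqOn f g (Metric.sphere c r)) :
    contourFunctional c r s q f = contourFunctional c r s q g := by
  unfold contourFunctional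
  congr 1
  exact circleIntegral.integral_congr hr.le fun z hz => by simp [h hz]

lemma contourFunctional_rootPoly_mul (hr : 0 < r) {t : Multiset ℂ}
    (ht : ∀ a ∈ t, a ∈ Metric.ball c r) (q : Polynomial ℂ) (f : ℂ → ℂ) :
    contourFunctional c r (t + s) (rootPoly t * q) f = contourFunctional c r s q f := by
  unfold contourFunctional
  congr 1
  refine circleIntegral.integral_congr hr.le fun z hz => ?_
  have := eval_rootPoly_ne_zero_of_mem_sphere ht hz
  simp only [rootPoly_add, Polynomial.eval_mul]
  rw [mul_div_mul_left _ _ this]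

lemma contourFunctional_cons_mul (hr : 0 < r) {a : ℂ} (ha : a ∈ Metric.ball c r)
    (q : Polynomial ℂ) (f : ℂ → ℂ) :
    contourFunctional c r (a ::ₘ s) ((Polynomial.X - Polynomial.C a) * q) f
      = contourFunctional c r s q f := by
  have := contourFunctional_rootPoly_mul (s := s) hr (t := {a}) (c := c) (by simpa using ha) q f
  simpa [rootPoly] using this

lemma contourFunctional_zero_eq_zero (hr : 0 < r) (q : Polynomial ℂ) {f : ℂ → ℂ}
    (hf : DiffContOnCl ℂ f (Metric.ball c r)) : contourFunctional c r 0 q f = 0 := by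
  unfold contourFunctional
  have hq : DiffContOnCl ℂ (fun z => q.eval z) (Metric.ball c r) :=
    q.differentiable.diffContOnCl
  have := (hf.smul hq).circleIntegral_eq_zero hr.le
  simp only [rootPoly_zero, Polynomial.eval_one, div_one]
  simp only [smul_eq_mul] at this
  rw [this, mul_zero]

/-- Once the denominator cancels, the integrand is holomorphic in the disc. Hence the functional
depends only on `q` modulo `rootPoly s`. -/
lemma contourFunctional_rootPoly_eq_zero (hr : 0 < r) (hs : ∀ a ∈ s, a ∈ Metric.ball c r)
    (q : Polynomial ℂ) {f : ℂ → ℂ} (hf : DiffContOnCl ℂ f (Metric.ball c r)) :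
    contourFunctional c r s (rootPoly s * q) f = 0 := by
  have := contourFunctional_rootPoly_mul (s := 0) hr hs q f
  rw [add_zero] at this
  rw [this, contourFunctional_zero_eq_zero hr q hf]

lemma contourFunctional_eq_zero_of_dvd (hr : 0 < r) (hs : ∀ a ∈ s, a ∈ Metric.ball c r)
    (q : Polynomial ℂ) {h g : ℂ → ℂ} (hg : DiffContOnCl ℂ g (Metric.ball c r))
    (hgh : ∀ z ∈ Metric.sphere c r, h z = (rootPoly s).eval z * g z) :
    contourFunctional c r s q h = 0 := by
  rw [contourFunctional_congr hr q (fun z hz => hgh z hz), ← contourFunctional_mul_left,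
    contourFunctional_rootPoly_eq_zero hr hs q hg]

/-- If all functionals attached to `s` vanish at `h`, then `∏ (z - a)` divides `h`. -/
lemma exists_eq_rootPoly_mul {U : Set ℂ} (hU : IsOpen U) (hr : 0 < r)
    (hs : ∀ a ∈ s, a ∈ Metric.ball c r) (hcU : Metric.closedBall c r ⊆ U) {h : ℂ → ℂ}
    (hh : DifferentiableOn ℂ h U) (h0 : ∀ q, contourFunctional c r s q h = 0) :
    ∃ g : ℂ → ℂ, DifferentiableOn ℂ g U ∧ ∀ z ∈ U, h z = (rootPoly s).eval z * g z := by
  set k : ℂ → ℂ := fun z => h z / (rootPoly s).eval z with hk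
  set G : ℂ → ℂ := fun w => (2 * Real.pi * I : ℂ)⁻¹ • ∮ z in C(c, r), (z - w)⁻¹ • k z with hG
  have hhs : ContinuousOn h (Metric.sphere c r) :=
    hh.continuousOn.mono (Metric.sphere_subset_closedBall.trans hcU)
  have hkc : ContinuousOn k (Metric.sphere c r) :=
    hhs.div (rootPoly s).continuous.continuousOn
      fun _ hz => eval_rootPoly_ne_zero_of_mem_sphere hs hz
  have hGd : DifferentiableOn ℂ G (Metric.ball c r) := by
    have := hasFPowerSeriesOn_cauchy_integral (c := c) (R := ⟨r, hr.le⟩) (f := k)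
      (hkc.circleIntegrable hr.le) hr
    have h2 := this.differentiableOn
    exact (Metric.eball_coe (x := c) (ε := (⟨r, hr.le⟩ : NNReal))) ▸ h2
  have hGP : ∀ w ∈ Metric.ball c r, h w = (rootPoly s).eval w * G w := by
    intro w hw
    have hdc : DiffContOnCl ℂ h (Metric.ball c r) :=
      (hh.mono hcU).diffContOnCl_ball (Set.Subset.refl _)
    have hcauchy := hdc.two_pi_i_inv_smul_circleIntegral_sub_inv_smul hw
    -- With P = `rootPoly s` and Q = (P - P(w))/(z - w), one has 1/(z - w) = P(w)/((z - w) P(z)) +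
    -- Q/P. The functional of Q vanishes at h, so Cauchy's formula for h becomes P(w) times the
    -- Cauchy integral of h/P.
    have hq := h0 (rootPoly s /ₘ (Polynomial.X - Polynomial.C w))
    have key : ∀ z ∈ Metric.sphere c r, (z - w)⁻¹ • h z
        = (rootPoly s).eval w * ((z - w)⁻¹ • k z)
          + h z * ((rootPoly s /ₘ (Polynomial.X - Polynomial.C w)).eval z
            / (rootPoly s).eval z) := by
      intro z hz
      have hP := eval_rootPoly_ne_zero_of_mem_sphere hs hz
      have hzw : z - w ≠ 0 := by
        intro h; rw [sub_eq_zero] at h; subst h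
        simp only [Metric.mem_ball, Metric.mem_sphere] at *
        linarith
      have hdiv := Polynomial.modByMonic_add_div (rootPoly s) (Polynomial.X - Polynomial.C w)
      have hev := congrArg (Polynomial.eval z) hdiv
      simp only [Polynomial.modByMonic_X_sub_C_eq_C_eval, Polynomial.eval_add, Polynomial.eval_C,
        Polynomial.eval_mul, Polynomial.eval_sub, Polynomial.eval_X] at hev
      simp only [hk, smul_eq_mul]
      field_simp
      rw [← hev]
    have hzwc : ContinuousOn (fun z => (z - w)⁻¹) (Metric.sphere c r) := by
      refine ContinuousOn.inv₀ (by fun_prop) fun z hz h => ?_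
      rw [sub_eq_zero] at h; subst h
      simp only [Metric.mem_ball, Metric.mem_sphere] at *
      linarith
    rw [circleIntegral.integral_congr hr.le key, circleIntegral.integral_add,
      circleIntegral.integral_const_mul, smul_add] at hcauchy
    · unfold contourFunctional at hq
      rw [smul_eq_mul, smul_eq_mul, hq, add_zero] at hcauchy
      rw [← hcauchy, hG]
      simp only [smul_eq_mul]; ring
    · exact (continuousOn_const.mul (hzwc.smul hkc)).circleIntegrable hr.le
    · exact (hhs.mul (continuousOn_ratio hs _)).circleIntegrable hr.le
  classical
  -- The quotient is the Cauchy integral `G` inside the disc and h/P outside; the two agree in the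
  -- disc wherever P is nonzero, and P has no zeros outside it, so they glue holomorphically.
  refine ⟨fun w => if w ∈ Metric.ball c r then G w else k w, ?_, ?_⟩
  · intro w hwU
    apply DifferentiableAt.differentiableWithinAt
    by_cases hw : w ∈ Metric.ball c r
    · have : (fun w => if w ∈ Metric.ball c r then G w else k w) =ᶠ[nhds w] G := by
        filter_upwards [Metric.isOpen_ball.mem_nhds hw] with z hz
        rw [if_pos hz]
      exact (hGd.differentiableAt (Metric.isOpen_ball.mem_nhds hw)).congr_of_eventuallyEq this
    · have hPw : (rootPoly s).eval w ≠ 0 := eval_rootPoly_ne_zero fun h => hw (hs w h)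
      have : (fun w => if w ∈ Metric.ball c r then G w else k w) =ᶠ[nhds w] k := by
        filter_upwards [(rootPoly s).continuous.continuousAt.eventually_ne hPw] with z hz
        split_ifs with hzb
        · rw [hk]; simp only; rw [hGP z hzb, mul_div_cancel_left₀ _ hz]
        · rfl
      refine DifferentiableAt.congr_of_eventuallyEq ?_ this
      exact (hh.differentiableAt (hU.mem_nhds hwU)).div (rootPoly s).differentiable.differentiableAt
        hPw
  · intro w hwU
    by_cases hw : w ∈ Metric.ball c r
    · simp only [if_pos hw]; exact hGP w hw
    · have hPw : (rootPoly s).eval w ≠ 0 := eval_rootPoly_ne_zero fun h => hw (hs w h)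
      simp only [if_neg hw, hk]; rw [mul_div_cancel₀ _ hPw]

end Functional

/-! ### Exponentially decaying functions on the half-line -/

/-- A continuous function on the line with exponential decay at `+∞`. -/
structure ExpDecay (g : ℝ → ℂ) : Prop where
  continuous : Continuous g
  bound : ∃ K δ : ℝ, 0 < δ ∧ ∀ x, 0 ≤ x → ‖g x‖ ≤ K * Real.exp (-(δ * x))

namespace ExpDecay

variable {g u k : ℝ → ℂ}

lemma integrableOn_mul (hg : ExpDecay g) (hu : ExpDecay u) :
    IntegrableOn (fun x => ‖g x‖ * ‖u x‖) (Set.Ioi 0) := by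
  obtain ⟨hgc, K, δ, hδ, hK⟩ := hg
  obtain ⟨huc, K', δ', hδ', hK'⟩ := hu
  have hi : IntegrableOn (fun x : ℝ => K * K' * Real.exp (-(δ + δ') * x)) (Set.Ioi 0) :=
    (exp_neg_integrableOn_Ioi 0 (by positivity)).const_mul _
  refine Integrable.mono' hi (by fun_prop) ?_
  filter_upwards [ae_restrict_mem measurableSet_Ioi] with x hx
  have hx0 : (0 : ℝ) ≤ x := le_of_lt hx
  rw [Real.norm_of_nonneg (by positivity)]
  calc ‖g x‖ * ‖u x‖ ≤ (K * Real.exp (-(δ * x))) * (K' * Real.exp (-(δ' * x))) :=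
        mul_le_mul (hK x hx0) (hK' x hx0) (norm_nonneg _) ((norm_nonneg _).trans (hK x hx0))
    _ = _ := by
        rw [mul_mul_mul_comm, ← Real.exp_add]; ring_nf

lemma integrableOn_sq (hg : ExpDecay g) : IntegrableOn (fun x => ‖g x‖ ^ 2) (Set.Ioi 0) := by
  simpa only [sq] using hg.integrableOn_mul hg

lemma tendsto (hg : ExpDecay g) : Filter.Tendsto g Filter.atTop (nhds 0) := by
  obtain ⟨hgc, K, δ, hδ, hK⟩ := hg
  refine squeeze_zero_norm' (a := fun x => K * Real.exp (-(δ * x))) ?_ ?_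
  · filter_upwards [Filter.eventually_ge_atTop 0] with x hx using hK x hx
  · have : Filter.Tendsto (fun x : ℝ => Real.exp (-(δ * x))) Filter.atTop (nhds 0) :=
      Real.tendsto_exp_neg_atTop_nhds_zero.comp (Filter.tendsto_id.const_mul_atTop hδ)
    simpa using this.const_mul K

/-- If `k' = u - a k`, passing from `u` to `u - 2 (Re a) k` increases the square of the `L²` norm
on the half-line by exactly `2 (Re a) |k 0|²`. -/
lemma integral_norm_sq_sub (hu : ExpDecay u) (hk : ExpDecay k) (a : ℂ)
    (hd : ∀ x, HasDerivAt k (u x - a * k x) x) :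
    ∫ x in Set.Ioi (0 : ℝ), ‖u x - 2 * a.re * k x‖ ^ 2
      = (∫ x in Set.Ioi (0 : ℝ), ‖u x‖ ^ 2) + 2 * a.re * ‖k 0‖ ^ 2 := by
  have hder : ∀ x, HasDerivAt (fun x => ‖k x‖ ^ 2)
      (2 * (inner ℝ (k x) (u x - a * k x))) x := fun x => (hd x).norm_sq
  -- The difference of the two squares is an exact derivative, -2 (Re a) (|k|²)', so integration
  -- leaves only the boundary value at 0.
  have hpt : ∀ x, ‖u x - 2 * a.re * k x‖ ^ 2
      = ‖u x‖ ^ 2 - 2 * a.re * (2 * (inner ℝ (k x) (u x - a * k x))) := by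
    intro x
    simp only [← Complex.normSq_eq_norm_sq, Complex.normSq_apply, Complex.inner]
    simp
    ring
  have hint : IntegrableOn (fun x => 2 * (inner ℝ (k x) (u x - a * k x))) (Set.Ioi 0) := by
    have h1 : IntegrableOn (fun x => 2 * (‖k x‖ * ‖u x‖ + ‖a‖ * ‖k x‖ ^ 2)) (Set.Ioi 0) :=
      ((hk.integrableOn_mul hu).add (hk.integrableOn_sq.const_mul _)).const_mul 2
    have hkc := hk.continuous
    have huc := hu.continuous
    refine Integrable.mono' h1 (by fun_prop) (Filter.Eventually.of_forall fun x => ?_)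
    rw [norm_mul, Real.norm_two]
    gcongr
    refine (norm_inner_le_norm _ _).trans ?_
    calc ‖k x‖ * ‖u x - a * k x‖ ≤ ‖k x‖ * (‖u x‖ + ‖a * k x‖) := by
          gcongr; exact norm_sub_le _ _
      _ = _ := by rw [norm_mul]; ring
  have hftc := integral_Ioi_of_hasDerivAt_of_tendsto (a := 0) (m := 0)
    (f := fun x => ‖k x‖ ^ 2)
    ((hder 0).continuousAt.continuousWithinAt) (fun x _ => hder x) hint
    (by simpa using (hk.tendsto.norm.pow 2))
  simp_rw [hpt]
  rw [integral_sub hu.integrableOn_sq (hint.const_mul _), integral_const_mul, hftc]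
  ring

end ExpDecay

lemma hasDerivAt_integral_exp {z K : ℝ → ℂ} (hz : Continuous z) (hK : Continuous K) (a b x : ℝ) :
    HasDerivAt (fun x : ℝ => ∫ θ in a..b, exp (-(z θ * x)) * K θ)
      (∫ θ in a..b, -z θ * exp (-(z θ * x)) * K θ) x := by
  have hcont : Continuous fun p : ℝ × ℝ => -z p.2 * exp (-(z p.2 * p.1)) * K p.2 := by fun_prop
  obtain ⟨M, hM⟩ := ((isCompact_closedBall x 1).prod (isCompact_uIcc (a := a) (b := b)))
    |>.exists_bound_of_continuousOn hcont.continuousOn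
  refine (intervalIntegral.hasDerivAt_integral_of_dominated_loc_of_deriv_le
    (F := fun (x θ : ℝ) => exp (-(z θ * x)) * K θ)
    (F' := fun (x θ : ℝ) => -z θ * exp (-(z θ * x)) * K θ) (bound := fun _ => M)
    (Metric.ball_mem_nhds x one_pos) ?_ ?_ ?_ ?_ ?_ ?_).2
  · exact Filter.Eventually.of_forall fun y => by fun_prop
  · exact Continuous.intervalIntegrable (by fun_prop) _ _
  · fun_prop
  · refine Filter.Eventually.of_forall fun θ hθ y hy => ?_
    exact hM (y, θ) ⟨Metric.ball_subset_closedBall hy, Set.uIoc_subset_uIcc hθ⟩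
  · exact intervalIntegrable_const
  · refine Filter.Eventually.of_forall fun θ _ y _ => ?_
    have h1 : HasDerivAt (fun y : ℝ => -(z θ * (y : ℂ))) (-z θ) y := by
      have := ((hasDerivAt_id y).ofReal_comp.const_mul (z θ)).neg
      simp only [Complex.ofReal_one, mul_one] at this
      exact this
    have := (h1.cexp).mul_const (K θ)
    exact this.congr_deriv (by ring)

/-! ### Exponential sums: derivative and decay -/

section ExpSum

variable {c : ℂ} {r : ℝ} {s : Multiset ℂ}

/-- Differentiating exp(-zx) brings down -z, which is absorbed into the polynomial: differentiation
acts as `q ↦ -X q`. -/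
lemma hasDerivAt_expSum (hr : 0 < r) (hs : ∀ a ∈ s, a ∈ Metric.ball c r) (q : Polynomial ℂ)
    (x : ℝ) : HasDerivAt (expSum c r s q) (expSum c r s (-(Polynomial.X * q)) x) x := by
  have hK : Continuous fun θ : ℝ => deriv (circleMap c r) θ *
      (q.eval (circleMap c r θ) / (rootPoly s).eval (circleMap c r θ)) := by
    have h1 : Continuous fun θ : ℝ =>
        q.eval (circleMap c r θ) / (rootPoly s).eval (circleMap c r θ) :=
      (continuousOn_ratio hs q).comp_continuous (continuous_circleMap c r)
        fun θ => circleMap_mem_sphere c hr.le θ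
    simp only [deriv_circleMap]
    fun_prop
  have h := (hasDerivAt_integral_exp (continuous_circleMap c r) hK 0 (2 * Real.pi) x).const_mul
    ((2 * Real.pi * I : ℂ)⁻¹)
  refine (h.congr_of_eventuallyEq (Filter.Eventually.of_forall fun y => ?_)).congr_deriv ?_
  · simp only [expSum, contourFunctional, circleIntegral, smul_eq_mul]
    congr 2; ext θ; ring
  · simp only [expSum, contourFunctional, circleIntegral, smul_eq_mul]
    congr 2; ext θ; simp; ring

lemma sub_le_re_of_mem_sphere {z : ℂ} (hz : z ∈ Metric.sphere c r) : c.re - r ≤ z.re := by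
  have h1 : ‖z - c‖ = r := by simpa [dist_eq_norm] using hz
  have h2 := Complex.abs_re_le_norm (z - c)
  rw [h1, abs_le, sub_re] at h2
  linarith [h2.1]

/-- The contour lies in Re z ≥ c.re - r > 0, which is the decay rate. -/
lemma expDecay_expSum (hr : 0 < r) (hrc : r < c.re) (hs : ∀ a ∈ s, a ∈ Metric.ball c r)
    (q : Polynomial ℂ) : ExpDecay (expSum c r s q) := by
  refine ⟨continuous_iff_continuousAt.2 fun x => (hasDerivAt_expSum hr hs q x).continuousAt, ?_⟩
  obtain ⟨M, hM⟩ := (isCompact_sphere c r).exists_bound_of_continuousOn (continuousOn_ratio hs q)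
  refine ⟨r * M, c.re - r, sub_pos.2 hrc, fun x hx => ?_⟩
  have h := circleIntegral.norm_two_pi_i_inv_smul_integral_le_of_norm_le_const (c := c) hr.le
    (f := fun z => exp (-(z * x)) * (q.eval z / (rootPoly s).eval z))
    (C := M * Real.exp (-((c.re - r) * x))) fun z hz => by
      rw [norm_mul, Complex.norm_exp, mul_comm]
      refine mul_le_mul (hM z hz) (Real.exp_le_exp.2 ?_) (Real.exp_pos _).le
        ((norm_nonneg _).trans (hM z hz))
      have := sub_le_re_of_mem_sphere hz
      simp only [neg_re, mul_re, ofReal_re, ofReal_im, mul_zero, sub_zero]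
      nlinarith
  rw [smul_eq_mul, ← mul_assoc] at h
  exact h

lemma expSum_add (hr : 0 < r) (hs : ∀ a ∈ s, a ∈ Metric.ball c r) (p q : Polynomial ℂ) (x : ℝ) :
    expSum c r s (p + q) x = expSum c r s p x + expSum c r s q x :=
  contourFunctional_add_left hr hs p q (by fun_prop)

lemma expSum_rootPoly_mul (hr : 0 < r) (hs : ∀ a ∈ s, a ∈ Metric.ball c r) (q : Polynomial ℂ)
    (x : ℝ) : expSum c r s (rootPoly s * q) x = 0 :=
  contourFunctional_rootPoly_eq_zero hr hs q
    (Differentiable.diffContOnCl (by fun_prop))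

lemma expSum_neg (q : Polynomial ℂ) (x : ℝ) : expSum c r s (-q) x = -expSum c r s q x :=
  contourFunctional_neg q _

end ExpSum

/-- The point -conj a lies in the left half-plane, so it is not a root of `rootPoly (a ::ₘ s)`, and
a multiple of that polynomial can be subtracted to make `q` vanish there. Modulo the polynomial,
every `q` thus has the form -(X + conj a) p, and induction on `s` can pass from `q` to `p`. -/
lemma exists_eq_neg_mul_add {a : ℂ} {s : Multiset ℂ} (ha : 0 < a.re) (hs : ∀ b ∈ s, 0 < b.re)
    (q : Polynomial ℂ) : ∃ (p : Polynomial ℂ) (b : ℂ),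
      q = -((Polynomial.X + Polynomial.C ((starRingEnd ℂ) a)) * p)
        + rootPoly (a ::ₘ s) * Polynomial.C b := by
  set w : ℂ := -(starRingEnd ℂ) a with hw
  have hP : (rootPoly (a ::ₘ s)).eval w ≠ 0 := eval_rootPoly_ne_zero fun h => by
    have h2 : 0 < w.re := by
      rcases Multiset.mem_cons.1 h with h | h
      · rwa [h]
      · exact hs _ h
    simp [hw] at h2
    linarith
  set b := q.eval w / (rootPoly (a ::ₘ s)).eval w with hb
  have hroot : (q - rootPoly (a ::ₘ s) * Polynomial.C b).IsRoot w := by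
    simp [hb, mul_div_cancel₀ _ hP]
  obtain ⟨p, hp⟩ := Polynomial.dvd_iff_isRoot.2 hroot
  refine ⟨-p, b, ?_⟩
  rw [sub_eq_iff_eq_add] at hp
  rw [hp, hw]
  simp

/-! ### Adding one exponent: L² norms and the Bernstein inequality -/

section Norms

variable {c : ℂ} {r : ℝ} {s : Multiset ℂ}

/-- The square of the `L²` norm of `expSum` on the half-line. -/
noncomputable def expSumNormSq (c : ℂ) (r : ℝ) (s : Multiset ℂ) (q : Polynomial ℂ) : ℝ :=
  ∫ x in Set.Ioi (0 : ℝ), ‖expSum c r s q x‖ ^ 2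

lemma expSumNormSq_nonneg (q : Polynomial ℂ) : 0 ≤ expSumNormSq c r s q :=
  integral_nonneg fun _ => by positivity

/-- Write -X = -(X - a) - a; the factor X - a cancels the new root. This is the equation k' = u - a
k required by `ExpDecay.integral_norm_sq_sub`, with u = -`expSum c r s p`. -/
lemma expSum_X_mul_cons (hr : 0 < r) {a : ℂ} (hs : ∀ b ∈ a ::ₘ s, b ∈ Metric.ball c r)
    (p : Polynomial ℂ) (x : ℝ) :
    expSum c r (a ::ₘ s) (-(Polynomial.X * p)) x
      = -expSum c r s p x - a * expSum c r (a ::ₘ s) p x := by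
  have h : -(Polynomial.X * p) = -((Polynomial.X - Polynomial.C a) * p)
      + Polynomial.C (-a) * p := by simp; ring
  have h2 : expSum c r (a ::ₘ s) ((Polynomial.X - Polynomial.C a) * p) x = expSum c r s p x :=
    contourFunctional_cons_mul hr (hs a (Multiset.mem_cons_self a s)) p _
  rw [h, expSum_add hr hs, expSum_neg, h2]
  have h3 : expSum c r (a ::ₘ s) (Polynomial.C (-a) * p) x
      = -a * expSum c r (a ::ₘ s) p x := contourFunctional_C_mul _ _ _
  rw [h3]; ring

lemma expSum_cons_eq (hr : 0 < r) {a : ℂ} (hs : ∀ b ∈ a ::ₘ s, b ∈ Metric.ball c r)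
    {p q e : Polynomial ℂ} (h : q = -((Polynomial.X + Polynomial.C ((starRingEnd ℂ) a)) * p)
        + rootPoly (a ::ₘ s) * e) (x : ℝ) :
    expSum c r (a ::ₘ s) q x
      = -expSum c r s p x - 2 * a.re * expSum c r (a ::ₘ s) p x := by
  have h1 : -((Polynomial.X + Polynomial.C ((starRingEnd ℂ) a)) * p)
      = -(Polynomial.X * p) + Polynomial.C (-(starRingEnd ℂ) a) * p := by simp; ring
  have h3 : expSum c r (a ::ₘ s) (Polynomial.C (-(starRingEnd ℂ) a) * p) x
      = -(starRingEnd ℂ) a * expSum c r (a ::ₘ s) p x := contourFunctional_C_mul _ _ _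
  rw [h, expSum_add hr hs, expSum_rootPoly_mul hr hs, h1, expSum_add hr hs,
    expSum_X_mul_cons hr hs, h3]
  have : (2 * a.re : ℂ) = a + (starRingEnd ℂ) a := by rw [Complex.add_conj]; push_cast; ring
  rw [this]; ring

/-- The counterpart for exponential sums of the orthogonal splitting of a model space into a
multiple of a smaller one and a one-dimensional piece; all inductions on `s` below rest on it. -/
lemma expSumNormSq_cons (hr : 0 < r) (hrc : r < c.re) {a : ℂ}
    (hs : ∀ b ∈ a ::ₘ s, b ∈ Metric.ball c r) {p q e : Polynomial ℂ}
    (h : q = -((Polynomial.X + Polynomial.C ((starRingEnd ℂ) a)) * p)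
        + rootPoly (a ::ₘ s) * e) :
    expSumNormSq c r (a ::ₘ s) q
      = expSumNormSq c r s p + 2 * a.re * ‖expSum c r (a ::ₘ s) p 0‖ ^ 2 := by
  have hs' : ∀ b ∈ s, b ∈ Metric.ball c r := fun b hb => hs b (Multiset.mem_cons_of_mem hb)
  unfold expSumNormSq
  simp_rw [expSum_cons_eq hr hs h]
  have hu : ExpDecay (fun x => -expSum c r s p x) := by
    have h := expDecay_expSum hr hrc hs' (-p)
    rwa [show expSum c r s (-p) = fun x => -expSum c r s p x from funext (expSum_neg p)] at h
  rw [hu.integral_norm_sq_sub (expDecay_expSum hr hrc hs p) a]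
  · simp only [norm_neg]
  · intro x
    rw [← expSum_X_mul_cons hr hs]
    exact hasDerivAt_expSum hr hs p x

/-- Twice the sum of the real parts. -/
noncomputable def reSum (s : Multiset ℂ) : ℝ := (s.map fun a => 2 * a.re).sum

lemma reSum_cons (a : ℂ) (s : Multiset ℂ) : reSum (a ::ₘ s) = 2 * a.re + reSum s := by
  simp [reSum]

lemma re_pos_of_mem_ball (hrc : r < c.re) {z : ℂ} (hz : z ∈ Metric.closedBall c r) :
    0 < z.re := by
  have h1 : ‖z - c‖ ≤ r := by simpa [dist_eq_norm] using hz
  have h2 := (Complex.abs_re_le_norm (z - c)).trans h1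
  rw [abs_le, sub_re] at h2
  linarith [h2.1]

lemma reSum_nonneg (hrc : r < c.re) (hs : ∀ a ∈ s, a ∈ Metric.ball c r) : 0 ≤ reSum s := by
  refine Multiset.sum_nonneg fun x hx => ?_
  obtain ⟨a, ha, rfl⟩ := Multiset.mem_map.1 hx
  have := re_pos_of_mem_ball hrc (Metric.ball_subset_closedBall (hs a ha))
  positivity

/-- The induction step is the Cauchy-Schwarz inequality (A + 2xB)² ≤ (X + 2x)(N + 2xB²), given A² ≤
XN. Here x = Re a, X and N are `reSum` and the squared norm for the smaller set, and A, B are the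
moduli at 0. -/
lemma norm_expSum_zero_sq_le (hr : 0 < r) (hrc : r < c.re) :
    ∀ s : Multiset ℂ, (∀ a ∈ s, a ∈ Metric.ball c r) → ∀ q : Polynomial ℂ,
      ‖expSum c r s q 0‖ ^ 2 ≤ reSum s * expSumNormSq c r s q := by
  intro s
  induction s using Multiset.induction_on with
  | empty =>
    intro hs q
    have := expSum_rootPoly_mul hr hs q 0
    rw [rootPoly_zero, one_mul] at this
    simp [this, reSum]
  | cons a s ih =>
    intro hs q
    have hs' : ∀ b ∈ s, b ∈ Metric.ball c r := fun b hb => hs b (Multiset.mem_cons_of_mem hb)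
    have hre : ∀ b ∈ a ::ₘ s, 0 < b.re := fun b hb =>
      re_pos_of_mem_ball hrc (Metric.ball_subset_closedBall (hs b hb))
    have ha := hre a (Multiset.mem_cons_self a s)
    obtain ⟨p, b, hpq⟩ := exists_eq_neg_mul_add ha
      (fun b hb => hre b (Multiset.mem_cons_of_mem hb)) q
    rw [expSumNormSq_cons hr hrc hs hpq, expSum_cons_eq hr hs hpq, reSum_cons]
    have hX := reSum_nonneg hrc hs'
    have hN := expSumNormSq_nonneg (c := c) (r := r) (s := s) p
    have hi := ih hs' p
    set N := expSumNormSq c r s p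
    set X := reSum s
    set x := a.re
    have h1 : ‖-expSum c r s p 0 - 2 * (x : ℂ) * expSum c r (a ::ₘ s) p 0‖
        ≤ ‖expSum c r s p 0‖ + 2 * x * ‖expSum c r (a ::ₘ s) p 0‖ := by
      refine (norm_sub_le _ _).trans (le_of_eq ?_)
      rw [norm_neg, norm_mul, norm_mul, Complex.norm_real, Real.norm_of_nonneg ha.le]
      simp
    set A := ‖expSum c r s p 0‖
    set B := ‖expSum c r (a ::ₘ s) p 0‖
    have hA : 0 ≤ A := norm_nonneg _
    have hB : 0 ≤ B := norm_nonneg _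
    have h2 : 2 * (A * B) ≤ X * B ^ 2 + N := by
      have hs1 := Real.sq_sqrt hX
      have hs2 := Real.sq_sqrt hN
      have : A ≤ √X * √N := by
        rw [← Real.sqrt_mul hX]
        exact Real.le_sqrt_of_sq_le hi
      nlinarith [sq_nonneg (√X * B - √N), mul_le_mul_of_nonneg_right this hB]
    calc _ ≤ (A + 2 * x * B) ^ 2 := by gcongr
      _ = A ^ 2 + 2 * x * (2 * (A * B)) + 4 * x ^ 2 * B ^ 2 := by ring
      _ ≤ X * N + 2 * x * (X * B ^ 2 + N) + 4 * x ^ 2 * B ^ 2 := by gcongr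
      _ = _ := by ring

/-- Differentiation is bounded on the span of exponentials, uniformly in the finite set of
exponents. -/
lemma expSumNormSq_X_mul_le (hr : 0 < r) (hrc : r < c.re) {M : ℝ} (hM : 0 ≤ M) :
    ∀ s : Multiset ℂ, (∀ a ∈ s, a ∈ Metric.ball c r) → (∀ a ∈ s, ‖a‖ ≤ M) → ∀ q : Polynomial ℂ,
      expSumNormSq c r s (-(Polynomial.X * q))
        ≤ (M + reSum s) ^ 2 * expSumNormSq c r s q := by
  intro s
  induction s using Multiset.induction_on with
  | empty =>
    intro hs _ q
    have h0 : ∀ q x, expSum c r 0 q x = 0 := fun q x => by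
      have := expSum_rootPoly_mul hr hs q x
      rwa [rootPoly_zero, one_mul] at this
    simp [expSumNormSq, h0]
  | cons a s ih =>
    intro hs hsM q
    have hs' : ∀ b ∈ s, b ∈ Metric.ball c r := fun b hb => hs b (Multiset.mem_cons_of_mem hb)
    have hre : ∀ b ∈ a ::ₘ s, 0 < b.re := fun b hb =>
      re_pos_of_mem_ball hrc (Metric.ball_subset_closedBall (hs b hb))
    have ha := hre a (Multiset.mem_cons_self a s)
    obtain ⟨p, b, hpq⟩ := exists_eq_neg_mul_add ha
      (fun b hb => hre b (Multiset.mem_cons_of_mem hb)) q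
    -- Differentiation preserves the decomposition: `q ↦ -X q` induces `p ↦ -X p`. So the norm
    -- recursion applies to both sides of the inequality, and the new boundary term is k'(0) =
    -- -u_s(0) - a k(0), with u_s and k the sums of `p` over `s` and `a ::ₘ s`.
    have hpq' : -(Polynomial.X * q)
        = -((Polynomial.X + Polynomial.C ((starRingEnd ℂ) a)) * -(Polynomial.X * p))
          + rootPoly (a ::ₘ s) * (Polynomial.C b * -Polynomial.X) := by
      rw [hpq]; ring
    rw [expSumNormSq_cons hr hrc hs hpq', expSumNormSq_cons hr hrc hs hpq,
      expSum_X_mul_cons hr hs, reSum_cons]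
    have hX := reSum_nonneg hrc hs'
    have hN := expSumNormSq_nonneg (c := c) (r := r) (s := s) p
    have hA2 := norm_expSum_zero_sq_le hr hrc s hs' p
    have hi := ih hs' (fun b hb => hsM b (Multiset.mem_cons_of_mem hb)) p
    set N := expSumNormSq c r s p
    set X := reSum s
    set x := a.re
    have h1 : ‖-expSum c r s p 0 - a * expSum c r (a ::ₘ s) p 0‖
        ≤ ‖expSum c r s p 0‖ + M * ‖expSum c r (a ::ₘ s) p 0‖ := by
      refine (norm_sub_le _ _).trans ?_
      rw [norm_neg, norm_mul]
      gcongr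
      exact hsM a (Multiset.mem_cons_self a s)
    set A := ‖expSum c r s p 0‖
    set B := ‖expSum c r (a ::ₘ s) p 0‖
    have hA : 0 ≤ A := norm_nonneg _
    have hB : 0 ≤ B := norm_nonneg _
    have h2 : 2 * (A * B) ≤ X * B ^ 2 + N := by
      have hs1 := Real.sq_sqrt hX
      have hs2 := Real.sq_sqrt hN
      have : A ≤ √X * √N := by
        rw [← Real.sqrt_mul hX]
        exact Real.le_sqrt_of_sq_le hA2
      nlinarith [sq_nonneg (√X * B - √N), mul_le_mul_of_nonneg_right this hB]
    calc _ ≤ (M + X) ^ 2 * N + 2 * x * (A + M * B) ^ 2 := by gcongr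
      _ = (M + X) ^ 2 * N + 2 * x * (A ^ 2 + M * (2 * (A * B)) + M ^ 2 * B ^ 2) := by ring
      _ ≤ (M + X) ^ 2 * N + 2 * x * (X * N + M * (X * B ^ 2 + N) + M ^ 2 * B ^ 2) := by gcongr
      _ ≤ _ := by
        -- The gap between the two sides is a polynomial with nonnegative coefficients in
        -- nonnegative quantities.
        have e : (M + (2 * x + X)) ^ 2 * (N + 2 * x * B ^ 2)
            - ((M + X) ^ 2 * N + 2 * x * (X * N + M * (X * B ^ 2 + N) + M ^ 2 * B ^ 2))
            = 2 * x * (2 * x + X + M) * N + 2 * x * (2 * x * (2 * x + 2 * X + 2 * M)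
              + X ^ 2 + M * X) * B ^ 2 := by ring
        have : 0 ≤ 2 * x * (2 * x + X + M) * N + 2 * x * (2 * x * (2 * x + 2 * X + 2 * M)
              + X ^ 2 + M * X) * B ^ 2 := by positivity
        linarith

end Norms

/-! ### Lagrange interpolation with error bound -/

/-- Rolle's theorem gives zeros of the derivative interlacing those of the function, which stay
strictly ordered, so one zero and one derivative are traded at each step. -/
lemma exists_iterated_deriv_eq_zero_of_seq (n : ℕ) : ∀ (φ : ℕ → ℝ → ℝ) (z : ℕ → ℝ),
    (∀ k x, HasDerivAt (φ k) (φ (k + 1) x) x) → (∀ i < n, z i < z (i + 1)) →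
    (∀ i ≤ n, φ 0 (z i) = 0) → ∃ ξ ∈ Set.Icc (z 0) (z n), φ n ξ = 0 := by
  induction n with
  | zero => intro φ z _ _ h; exact ⟨z 0, ⟨le_rfl, le_rfl⟩, h 0 le_rfl⟩
  | succ n ih =>
    intro φ z hφ hz h0
    have hex : ∀ i, ∃ y, i ≤ n → y ∈ Set.Ioo (z i) (z (i + 1)) ∧ φ 1 y = 0 := by
      intro i
      by_cases hi : i ≤ n
      · obtain ⟨y, hy, hy0⟩ := exists_hasDerivAt_eq_zero (hz i (by omega))
          (fun x _ => (hφ 0 x).continuousAt.continuousWithinAt)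
          ((h0 i (by omega)).trans (h0 (i + 1) (by omega)).symm) (fun x _ => hφ 0 x)
        exact ⟨y, fun _ => ⟨hy, hy0⟩⟩
      · exact ⟨0, fun h => absurd h hi⟩
    choose ζ hζ using hex
    obtain ⟨ξ, hξ, hξ0⟩ := ih (fun k => φ (k + 1)) ζ (fun k x => hφ (k + 1) x)
      (fun i hi => (hζ i hi.le).1.2.trans (hζ (i + 1) hi).1.1) (fun i hi => (hζ i hi).2)
    exact ⟨ξ, ⟨(hζ 0 (by omega)).1.1.le.trans hξ.1, hξ.2.trans (hζ n le_rfl).1.2.le⟩, hξ0⟩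

/-- Generalized Rolle theorem: `n + 1` zeros of a function give a zero of the `n`-th derivative. -/
lemma exists_iterated_deriv_eq_zero {n : ℕ} {φ : ℕ → ℝ → ℝ} {Z : Finset ℝ} {a b : ℝ}
    (hφ : ∀ k x, HasDerivAt (φ k) (φ (k + 1) x) x) (hcard : Z.card = n + 1)
    (hZ : ∀ z ∈ Z, z ∈ Set.Icc a b) (h0 : ∀ z ∈ Z, φ 0 z = 0) : ∃ ξ ∈ Set.Icc a b, φ n ξ = 0 := by
  set e := Z.orderEmbOfFin hcard
  set z : ℕ → ℝ := fun i => if h : i < n + 1 then e ⟨i, h⟩ else 0 with hz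
  have hmem : ∀ i ≤ n, z i ∈ Z := fun i hi => by
    simp only [hz, dif_pos (Nat.lt_succ_of_le hi)]
    exact Z.orderEmbOfFin_mem hcard _
  obtain ⟨ξ, hξ, h⟩ := exists_iterated_deriv_eq_zero_of_seq n φ z hφ (fun i hi => by
    simp only [hz, dif_pos (show i < n + 1 by omega), dif_pos (show i + 1 < n + 1 by omega)]
    exact e.strictMono (by simp)) (fun i hi => h0 _ (hmem i hi))
  exact ⟨ξ, ⟨(hZ _ (hmem 0 (by omega))).1.trans hξ.1, hξ.2.trans (hZ _ (hmem n le_rfl)).2⟩, h⟩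

lemma iterate_derivative_eq_factorial_of_monic {p : Polynomial ℝ} (hp : p.Monic) :
    Polynomial.derivative^[p.natDegree] p = Polynomial.C (p.natDegree.factorial : ℝ) := by
  have h := Polynomial.natDegree_iterate_derivative p p.natDegree
  rw [Nat.sub_self, Nat.le_zero] at h
  rw [Polynomial.eq_C_of_natDegree_eq_zero h, Polynomial.coeff_iterate_derivative]
  simp [hp, Nat.descFactorial_self]

/-- The error of Lagrange interpolation. -/
lemma abs_sub_eval_interpolate_le {φ : ℕ → ℝ → ℝ} {Z : Finset ℝ} {a b B : ℝ}
    (hφ : ∀ k x, HasDerivAt (φ k) (φ (k + 1) x) x) (hZ : ∀ z ∈ Z, z ∈ Set.Icc a b)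
    (hB : ∀ x ∈ Set.Icc a b, |φ Z.card x| ≤ B) {x : ℝ} (hx : x ∈ Set.Icc a b) :
    |φ 0 x - (Lagrange.interpolate Z id (φ 0)).eval x|
      ≤ B * ((b - a) ^ Z.card / (Z.card.factorial : ℝ)) := by
  have hB0 : 0 ≤ B := (abs_nonneg _).trans (hB x hx)
  have hab : 0 ≤ b - a := by linarith [hx.1, hx.2]
  set P := Lagrange.interpolate Z id (φ 0) with hP
  have hnode : ∀ z ∈ Z, P.eval z = φ 0 z := fun z hz =>
    Lagrange.eval_interpolate_at_node (v := id) (φ 0) (Set.injOn_id _) hz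
  by_cases hxZ : x ∈ Z
  · rw [hnode x hxZ, sub_self, abs_zero]; positivity
  set ω := Lagrange.nodal Z (id : ℝ → ℝ) with hω
  have hωx : ω.eval x ≠ 0 := Lagrange.eval_nodal_not_at_node fun z hz h => hxZ (h ▸ hz)
  -- This choice makes φ - P - K ω vanish at `x` in addition to the nodes, hence at one more point
  -- than the number of nodes.
  set K := (φ 0 x - P.eval x) / ω.eval x with hK
  set Q := P + Polynomial.C K * ω with hQ
  obtain ⟨ξ, hξ, hξ0⟩ := exists_iterated_deriv_eq_zero (n := Z.card) (Z := insert x Z)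
    (φ := fun k y => φ k y - (Polynomial.derivative^[k] Q).eval y) (a := a) (b := b)
    (fun k y => by
      rw [Function.iterate_succ_apply']
      exact (hφ k y).sub (Polynomial.hasDerivAt _ _))
    (Finset.card_insert_of_notMem hxZ)
    (fun z hz => by
      rcases Finset.mem_insert.1 hz with rfl | hz
      · exact hx
      · exact hZ z hz)
    (fun z hz => by
      rcases Finset.mem_insert.1 hz with rfl | hz
      · simp [hQ, hK, div_mul_cancel₀ _ hωx]
      · have : ω.eval z = 0 := Lagrange.eval_nodal_at_node (v := id) hz
        simp [hQ, hnode z hz, this])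
  have hdP : Polynomial.derivative^[Z.card] P = 0 := by
    by_cases h0 : P = 0
    · rw [h0]; simp
    · refine Polynomial.iterate_derivative_eq_zero ?_
      rw [Polynomial.natDegree_lt_iff_degree_lt h0]
      exact Lagrange.degree_interpolate_lt _ (Set.injOn_id _)
  have hdω : Polynomial.derivative^[Z.card] ω = Polynomial.C (Z.card.factorial : ℝ) := by
    have hd : ω.natDegree = Z.card := Lagrange.natDegree_nodal
    have := iterate_derivative_eq_factorial_of_monic (Lagrange.nodal_monic (s := Z) (v := id))
    rwa [← hω, hd] at this
  simp only [hQ, iterate_map_add, Polynomial.iterate_derivative_C_mul, hdP, hdω,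
    zero_add, Polynomial.eval_mul, Polynomial.eval_C, sub_eq_zero] at hξ0
  have hfac : (0 : ℝ) < Z.card.factorial := by exact_mod_cast Nat.factorial_pos _
  have hωle : |ω.eval x| ≤ (b - a) ^ Z.card := by
    rw [hω, Lagrange.eval_nodal, Finset.abs_prod]
    rw [← Finset.prod_const]
    refine Finset.prod_le_prod (fun _ _ => abs_nonneg _) fun z hz => ?_
    rw [abs_le]
    have := hZ z hz
    constructor <;> simp only [id] <;> linarith [this.1, this.2, hx.1, hx.2]
  have hval : φ 0 x - P.eval x = φ Z.card ξ * (ω.eval x / Z.card.factorial) := by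
    rw [hξ0, hK]; field_simp
  rw [hval, abs_mul, abs_div, abs_of_pos hfac]
  gcongr
  exact hB ξ hξ

/-- A function is controlled by its values at finitely many nodes and its higher derivatives. -/
lemma exists_norm_le_sum_nodes (Z : Finset ℝ) {a b : ℝ} (hZ : ∀ z ∈ Z, z ∈ Set.Icc a b) :
    ∃ Λ : ℝ, 0 ≤ Λ ∧ ∀ (u : ℕ → ℝ → ℂ) (B : ℝ), (∀ k x, HasDerivAt (u k) (u (k + 1) x) x) →
      (∀ x ∈ Set.Icc a b, ‖u Z.card x‖ ≤ B) → ∀ x ∈ Set.Icc a b,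
        ‖u 0 x‖ ≤ 2 * (B * ((b - a) ^ Z.card / (Z.card.factorial : ℝ)))
          + 2 * (Λ * ∑ z ∈ Z, ‖u 0 z‖) := by
  have hΛ : ∃ Λ : ℝ, 0 ≤ Λ ∧ ∀ z ∈ Z, ∀ x ∈ Set.Icc a b, |(Lagrange.basis Z id z).eval x| ≤ Λ := by
    have : ∀ z, ∃ M, ∀ x ∈ Set.Icc a b, ‖(Lagrange.basis Z id z).eval x‖ ≤ M := fun z =>
      isCompact_Icc.exists_bound_of_continuousOn (Lagrange.basis Z id z).continuous.continuousOn
    choose M hM using this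
    refine ⟨∑ z ∈ Z, |M z|, Finset.sum_nonneg fun _ _ => abs_nonneg _, fun z hz x hx => ?_⟩
    exact (hM z x hx).trans ((le_abs_self _).trans
      (Finset.single_le_sum (f := fun z => |M z|) (fun _ _ => abs_nonneg _) hz))
  obtain ⟨Λ, hΛ0, hΛ⟩ := hΛ
  refine ⟨Λ, hΛ0, fun u B hu hB x hx => ?_⟩
  -- Rolle's theorem is real, so the real and imaginary parts are treated separately; adding them
  -- gives the factors 2.
  have main : ∀ ρ : ℂ →L[ℝ] ℝ, (∀ z, |ρ z| ≤ ‖z‖) →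
      |ρ (u 0 x)| ≤ B * ((b - a) ^ Z.card / (Z.card.factorial : ℝ)) + Λ * ∑ z ∈ Z, ‖u 0 z‖ := by
    intro ρ hρ
    have h1 := abs_sub_eval_interpolate_le (φ := fun k x => ρ (u k x))
      (fun k x => ρ.hasFDerivAt.comp_hasDerivAt x (hu k x)) hZ
      (fun x hx => (hρ _).trans (hB x hx)) hx
    have h2 : |(Lagrange.interpolate Z id fun x => ρ (u 0 x)).eval x|
        ≤ Λ * ∑ z ∈ Z, ‖u 0 z‖ := by
      rw [Lagrange.interpolate_apply, Polynomial.eval_finsetSum, Finset.mul_sum]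
      refine (Finset.abs_sum_le_sum_abs _ _).trans (Finset.sum_le_sum fun z hz => ?_)
      rw [Polynomial.eval_mul, Polynomial.eval_C, abs_mul, mul_comm]
      exact mul_le_mul (hΛ z hz x hx) (hρ _) (abs_nonneg _) hΛ0
    have h3 := abs_add_le (ρ (u 0 x) - (Lagrange.interpolate Z id fun x => ρ (u 0 x)).eval x)
      ((Lagrange.interpolate Z id fun x => ρ (u 0 x)).eval x)
    rw [sub_add_cancel] at h3
    linarith
  have hre := main Complex.reCLM Complex.abs_re_le_norm
  have him := main Complex.imCLM Complex.abs_im_le_norm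
  have := Complex.norm_le_abs_re_add_abs_im (u 0 x)
  simp only [Complex.reCLM_apply, Complex.imCLM_apply] at hre him
  linarith

/-! ### Sampling at log n as a Riemann sum -/

section Riemann

variable {u v : ℝ → ℂ}

/-- The derivative of |u|² is 2 Re⟨u, v⟩, of modulus at most |u|² + |v|². -/
lemma norm_sq_le_add_integral (hu : ∀ x, HasDerivAt u (v x) x) (hv : Continuous v) {a b x y : ℝ}
    (hx : x ∈ Set.Icc a b) (hy : y ∈ Set.Icc a b) :
    ‖u y‖ ^ 2 ≤ ‖u x‖ ^ 2 + ∫ t in a..b, (‖u t‖ ^ 2 + ‖v t‖ ^ 2) := by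
  have huc : Continuous u := continuous_iff_continuousAt.2 fun x => (hu x).continuousAt
  have hder : ∀ t, HasDerivAt (fun t => ‖u t‖ ^ 2) (2 * (inner ℝ (u t) (v t))) t :=
    fun t => (hu t).norm_sq
  have hc : Continuous fun t => 2 * (inner ℝ (u t) (v t)) := by fun_prop
  have hw : Continuous fun t => ‖u t‖ ^ 2 + ‖v t‖ ^ 2 := by fun_prop
  have hftc := intervalIntegral.integral_eq_sub_of_hasDerivAt (a := x) (b := y)
    (fun t _ => hder t) (hc.intervalIntegrable _ _)
  have hbd : ∀ t, ‖2 * (inner ℝ (u t) (v t))‖ ≤ ‖u t‖ ^ 2 + ‖v t‖ ^ 2 := by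
    intro t
    rw [norm_mul, Real.norm_two]
    have := norm_inner_le_norm (𝕜 := ℝ) (u t) (v t)
    nlinarith [sq_nonneg (‖u t‖ - ‖v t‖)]
  have hle : ‖∫ t in x..y, 2 * (inner ℝ (u t) (v t))‖
      ≤ ∫ t in a..b, (‖u t‖ ^ 2 + ‖v t‖ ^ 2) := by
    refine intervalIntegral.norm_integral_le_integral_norm_uIoc.trans ?_
    have hab : a ≤ b := hx.1.trans hx.2
    rw [intervalIntegral.integral_of_le hab]
    have hsub : Set.uIoc x y ⊆ Set.Ioc a b := by
      rw [Set.uIoc]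
      exact Set.Ioc_subset_Ioc (le_min hx.1 hy.1) (max_le hx.2 hy.2)
    have hi : IntegrableOn (fun t => ‖u t‖ ^ 2 + ‖v t‖ ^ 2) (Set.Ioc a b) :=
      hw.integrableOn_Icc.mono_set Set.Ioc_subset_Icc_self
    calc _ ≤ ∫ t in Set.uIoc x y, (‖u t‖ ^ 2 + ‖v t‖ ^ 2) :=
          integral_mono_of_nonneg (Filter.Eventually.of_forall fun _ => norm_nonneg _)
            (hi.mono_set hsub) (Filter.Eventually.of_forall hbd)
      _ ≤ _ := setIntegral_mono_set hi (Filter.Eventually.of_forall fun _ => by positivity)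
          hsub.eventuallyLE
  rw [hftc, Real.norm_eq_abs] at hle
  linarith [(le_abs_self _).trans hle]

/-- Compare the value at `x` with the value at a point going to infinity, where `u` vanishes in the
limit. -/
lemma norm_sq_le_integral_Ioi (hu : ∀ x, HasDerivAt u (v x) x) (hud : ExpDecay u)
    (hvd : ExpDecay v) {x : ℝ} (hx : 0 ≤ x) :
    ‖u x‖ ^ 2 ≤ (∫ t in Set.Ioi (0 : ℝ), ‖u t‖ ^ 2) + ∫ t in Set.Ioi (0 : ℝ), ‖v t‖ ^ 2 := by
  rw [← integral_add hud.integrableOn_sq hvd.integrableOn_sq]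
  have hlim : Filter.Tendsto (fun y => ‖u y‖ ^ 2
      + ∫ t in (0 : ℝ)..y, (‖u t‖ ^ 2 + ‖v t‖ ^ 2)) Filter.atTop
      (nhds (0 + ∫ t in Set.Ioi (0 : ℝ), (‖u t‖ ^ 2 + ‖v t‖ ^ 2))) := by
    refine Filter.Tendsto.add (by simpa using hud.tendsto.norm.pow 2) ?_
    exact intervalIntegral_tendsto_integral_Ioi 0
      (hud.integrableOn_sq.add hvd.integrableOn_sq) Filter.tendsto_id
  rw [zero_add] at hlim
  refine ge_of_tendsto hlim ?_
  filter_upwards [Filter.eventually_ge_atTop x] with y hy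
  exact norm_sq_le_add_integral hu hvd.continuous ⟨hx.trans hy, le_rfl⟩ ⟨hx, hy⟩

/-- The interval has length at most 1/n, and on it |u|² exceeds its value at the left end by at most
the integral of |u|² + |v|². -/
lemma integral_log_interval_le (hu : ∀ x, HasDerivAt u (v x) x) (hv : Continuous v) {n : ℕ}
    (hn : 0 < n) :
    ∫ t in Real.log n..Real.log (n + 1), ‖u t‖ ^ 2
      ≤ ‖u (Real.log n)‖ ^ 2 / n
        + (1 / n) * ∫ t in Real.log n..Real.log (n + 1), (‖u t‖ ^ 2 + ‖v t‖ ^ 2) := by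
  have hn' : (0 : ℝ) < n := by exact_mod_cast hn
  have huc : Continuous u := continuous_iff_continuousAt.2 fun x => (hu x).continuousAt
  have hle : Real.log n ≤ Real.log (n + 1) := Real.log_le_log hn' (by linarith)
  set W := ∫ t in Real.log n..Real.log (n + 1), (‖u t‖ ^ 2 + ‖v t‖ ^ 2)
  have hW : 0 ≤ W := intervalIntegral.integral_nonneg hle fun _ _ => by positivity
  have h1 : ∫ t in Real.log n..Real.log (n + 1), ‖u t‖ ^ 2
      ≤ ∫ _ in Real.log n..Real.log (n + 1), (‖u (Real.log n)‖ ^ 2 + W) := by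
    refine intervalIntegral.integral_mono_on hle (by apply Continuous.intervalIntegrable; fun_prop)
      intervalIntegrable_const fun t ht => ?_
    exact norm_sq_le_add_integral hu hv ⟨le_rfl, hle⟩ ht
  rw [intervalIntegral.integral_const, smul_eq_mul] at h1
  have h2 : Real.log (n + 1) - Real.log n ≤ 1 / n := by
    rw [← Real.log_div (by positivity) hn'.ne']
    refine (Real.log_le_sub_one_of_pos (by positivity)).trans (le_of_eq ?_)
    field_simp; ring
  refine h1.trans ((mul_le_mul_of_nonneg_right h2 (by positivity)).trans (le_of_eq ?_))
  ring

/-- Sum the estimates over the intervals from log (K+1) on. The factors 1/(k+1) are at most 1/(K+1),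
so the error can be made small by starting late. -/
lemma integral_Ioi_log_le (hu : ∀ x, HasDerivAt u (v x) x) (hud : ExpDecay u)
    (hvd : ExpDecay v) (K : ℕ)
    (hsum : Summable fun n : ℕ => ‖u (Real.log (n + 1))‖ ^ 2 / (n + 1)) :
    ∫ t in Set.Ioi (Real.log (K + 1)), ‖u t‖ ^ 2
      ≤ (∑' n : ℕ, ‖u (Real.log (n + 1))‖ ^ 2 / (n + 1))
        + (1 / (K + 1)) * ((∫ t in Set.Ioi (0 : ℝ), ‖u t‖ ^ 2)
          + ∫ t in Set.Ioi (0 : ℝ), ‖v t‖ ^ 2) := by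
  have huc := hud.continuous
  have hvc := hvd.continuous
  have hwi : IntegrableOn (fun t => ‖u t‖ ^ 2 + ‖v t‖ ^ 2) (Set.Ioi 0) :=
    hud.integrableOn_sq.add hvd.integrableOn_sq
  have hlog0 : ∀ k : ℕ, 0 ≤ Real.log (k + 1) := fun k =>
    Real.log_nonneg (by linarith [(Nat.cast_nonneg k : (0 : ℝ) ≤ k)])
  have hlogtop : Filter.Tendsto (fun m : ℕ => Real.log (m + 1)) Filter.atTop Filter.atTop := by
    refine Real.tendsto_log_atTop.comp ?_
    exact Filter.tendsto_atTop_add_const_right _ _ tendsto_natCast_atTop_atTop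
  rw [← integral_add hud.integrableOn_sq hvd.integrableOn_sq]
  have hlim := intervalIntegral_tendsto_integral_Ioi (Real.log (K + 1))
    (hud.integrableOn_sq.mono_set (Set.Ioi_subset_Ioi (hlog0 K))) hlogtop
  refine le_of_tendsto hlim ?_
  filter_upwards [Filter.eventually_ge_atTop K] with m hm
  have hadj : ∀ {f : ℝ → ℝ}, Continuous f → ∑ k ∈ Finset.Ico K m,
      ∫ t in Real.log (k + 1)..Real.log ((k + 1 : ℕ) + 1), f t
        = ∫ t in Real.log (K + 1)..Real.log (m + 1), f t := fun {f} hf =>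
    intervalIntegral.sum_integral_adjacent_intervals_Ico (a := fun k : ℕ => Real.log (k + 1)) hm
      fun k _ => hf.intervalIntegrable _ _
  have hstep : ∀ k ∈ Finset.Ico K m,
      ∫ t in Real.log (k + 1)..Real.log ((k + 1 : ℕ) + 1), ‖u t‖ ^ 2
        ≤ ‖u (Real.log (k + 1))‖ ^ 2 / (k + 1) + (1 / (K + 1)) *
          ∫ t in Real.log (k + 1)..Real.log ((k + 1 : ℕ) + 1), (‖u t‖ ^ 2 + ‖v t‖ ^ 2) := by
    intro k hk
    have h := integral_log_interval_le hu hvc (Nat.succ_pos k)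
    have hKk : (K : ℝ) ≤ k := by exact_mod_cast (Finset.mem_Ico.1 hk).1
    have hW : 0 ≤ ∫ t in Real.log (k + 1)..Real.log ((k + 1 : ℕ) + 1),
        (‖u t‖ ^ 2 + ‖v t‖ ^ 2) := by
      refine intervalIntegral.integral_nonneg (Real.log_le_log (by positivity) ?_)
        fun _ _ => by positivity
      push_cast; linarith
    rw [Nat.succ_eq_add_one] at h
    have hcast : ((k + 1 : ℕ) : ℝ) = (k : ℝ) + 1 := by push_cast; ring
    simp only [hcast] at h hW ⊢
    refine h.trans ?_
    gcongr
  rw [← hadj (by fun_prop)]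
  refine (Finset.sum_le_sum hstep).trans ?_
  rw [Finset.sum_add_distrib, ← Finset.mul_sum, hadj (by fun_prop)]
  gcongr
  · exact hsum.sum_le_tsum _ fun _ _ => by positivity
  · rw [intervalIntegral.integral_of_le (Real.log_le_log (by positivity)
      (by gcongr))]
    exact setIntegral_mono_set hwi (Filter.Eventually.of_forall fun _ => by positivity)
      (Set.Ioc_subset_Ioi_self.trans (Set.Ioi_subset_Ioi (hlog0 K))).eventuallyLE

end Riemann

/-! ### The sampling inequality -/

/-- The two summands are the coefficients of ‖u‖² in the head and tail errors of the sampling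
inequality, to be absorbed together. With n = K + 1 and n^n/n! ≤ e^n, the interpolation factor is at
most (R e log n / n)^n, eventually below 2^(-n). -/
lemma exists_interpolation_degree (R : ℝ) (hR : 0 ≤ R) : ∃ K : ℕ,
    8 * Real.log (K + 1) * (1 + R ^ 2) * (R ^ (K + 1) * (Real.log (K + 1) ^ (K + 1)
      / ((K + 1).factorial : ℝ))) ^ 2 + (1 + R ^ 2) / (K + 1) ≤ 1 / 2 := by
  have h1 : Filter.Tendsto (fun n : ℕ => 8 * (1 + R ^ 2) * ((n : ℝ) * (1 / 4 : ℝ) ^ n)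
      + (1 + R ^ 2) * (n : ℝ)⁻¹) Filter.atTop
      (nhds (8 * (1 + R ^ 2) * 0 + (1 + R ^ 2) * 0)) :=
    ((tendsto_self_mul_const_pow_of_lt_one (by norm_num) (by norm_num)).const_mul _).add
      ((tendsto_inv_atTop_nhds_zero_nat (𝕜 := ℝ)).const_mul _)
  have h2 : Filter.Tendsto (fun n : ℕ => Real.log n / n) Filter.atTop (nhds 0) :=
    (Real.isLittleO_log_id_atTop.tendsto_div_nhds_zero).comp tendsto_natCast_atTop_atTop
  have h3 : Filter.Tendsto (fun n : ℕ => R * Real.exp 1 * (Real.log n / n)) Filter.atTop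
      (nhds (R * Real.exp 1 * 0)) := h2.const_mul _
  have e1 := h1.eventually_le_const (u := 1 / 2) (by norm_num)
  have e3 := h3.eventually_le_const (u := 1 / 2) (by norm_num)
  obtain ⟨n, hn1, hn3, hn0⟩ := (e1.and (e3.and (Filter.eventually_ge_atTop 1))).exists
  obtain ⟨K, rfl⟩ : ∃ K, n = K + 1 := ⟨n - 1, by omega⟩
  refine ⟨K, le_trans ?_ hn1⟩
  set n := K + 1 with hn
  have hcast : ((K : ℝ) + 1) = (n : ℝ) := by rw [hn]; push_cast; ring
  have hnpos : (0 : ℝ) < n := by rw [← hcast]; positivity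
  rw [hcast]
  have hlog : 0 ≤ Real.log n := Real.log_nonneg (by rw [← hcast]; linarith [(Nat.cast_nonneg K : (0 : ℝ) ≤ K)])
  have hlogn : Real.log n ≤ n := (Real.log_le_sub_one_of_pos hnpos).trans (by linarith)
  have hfac : (0 : ℝ) < n.factorial := by exact_mod_cast Nat.factorial_pos _
  have hpow : R ^ n * (Real.log n ^ n / (n.factorial : ℝ)) ≤ (1 / 2) ^ n := by
    have he := Real.pow_div_factorial_le_exp (n : ℝ) hnpos.le n
    calc R ^ n * (Real.log n ^ n / (n.factorial : ℝ))
        = (R * (Real.log n / n)) ^ n * ((n : ℝ) ^ n / n.factorial) := by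
          rw [mul_pow, div_pow]; field_simp
      _ ≤ (R * (Real.log n / n)) ^ n * Real.exp n := by gcongr
      _ = (R * Real.exp 1 * (Real.log n / n)) ^ n := by
          rw [show Real.exp n = Real.exp 1 ^ n by rw [← Real.exp_nat_mul, mul_one], ← mul_pow]
          ring_nf
      _ ≤ (1 / 2) ^ n := by gcongr
  have hq : (R ^ n * (Real.log n ^ n / (n.factorial : ℝ))) ^ 2 ≤ (1 / 4) ^ n := by
    calc _ ≤ ((1 / 2 : ℝ) ^ n) ^ 2 := by gcongr
      _ = _ := by rw [← pow_mul, mul_comm, pow_mul]; norm_num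
  calc _ ≤ 8 * n * (1 + R ^ 2) * (1 / 4) ^ n + (1 + R ^ 2) / n := by gcongr
    _ = _ := by ring

/-- Sampling at the points `log n` with weights `1 / n` bounds the `L²` norm on the half-line of a
function whose derivatives grow at most geometrically in `L²`. -/
theorem exists_integral_norm_sq_le_tsum (R : ℝ) (hR : 0 ≤ R) : ∃ C : ℝ, 0 < C ∧
    ∀ u : ℕ → ℝ → ℂ, (∀ k x, HasDerivAt (u k) (u (k + 1) x) x) → (∀ k, ExpDecay (u k)) →
      (∀ k, ∫ x in Set.Ioi (0 : ℝ), ‖u (k + 1) x‖ ^ 2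
        ≤ R ^ 2 * ∫ x in Set.Ioi (0 : ℝ), ‖u k x‖ ^ 2) →
      (Summable fun n : ℕ => ‖u 0 (Real.log (n + 1))‖ ^ 2 / (n + 1)) →
      ∫ x in Set.Ioi (0 : ℝ), ‖u 0 x‖ ^ 2
        ≤ C * ∑' n : ℕ, ‖u 0 (Real.log (n + 1))‖ ^ 2 / (n + 1) := by
  obtain ⟨K, hK⟩ := exists_interpolation_degree R hR
  set L := Real.log (K + 1) with hL
  have hlog0 : ∀ k : ℕ, 0 ≤ Real.log (k + 1) := fun k =>
    Real.log_nonneg (by linarith [(Nat.cast_nonneg k : (0 : ℝ) ≤ k)])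
  have hL0 : 0 ≤ L := hlog0 K
  have hinj : Function.Injective fun n : ℕ => Real.log (n + 1) := by
    intro m n h
    have := Real.log_injOn_pos (Set.mem_Ioi.2 (by positivity)) (Set.mem_Ioi.2 (by positivity)) h
    exact_mod_cast add_right_cancel this
  set Z := (Finset.range (K + 1)).image fun n : ℕ => Real.log (n + 1) with hZdef
  have hZcard : Z.card = K + 1 := by
    rw [hZdef, Finset.card_image_of_injective _ hinj, Finset.card_range]
  have hZ : ∀ z ∈ Z, z ∈ Set.Icc 0 L := by
    intro z hz
    obtain ⟨n, hn, rfl⟩ := Finset.mem_image.1 hz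
    refine ⟨hlog0 n, Real.log_le_log (by positivity) ?_⟩
    have : (n : ℝ) ≤ K := by exact_mod_cast Nat.lt_succ_iff.1 (Finset.mem_range.1 hn)
    linarith
  obtain ⟨Λ, hΛ0, hΛ⟩ := exists_norm_le_sum_nodes Z hZ
  -- The bracket adds the coefficients of the sample sum in the tail (1) and the head; the factor 2
  -- comes from absorbing half of the squared norm.
  refine ⟨2 * (1 + 8 * L * Λ ^ 2 * (K + 1) ^ 2), by positivity, fun u hu hd hRu hsum => ?_⟩
  set J : ℝ := ∫ x in Set.Ioi (0 : ℝ), ‖u 0 x‖ ^ 2 with hJ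
  set T := ∑' n : ℕ, ‖u 0 (Real.log (n + 1))‖ ^ 2 / (n + 1) with hT
  have hJ0 : 0 ≤ J := integral_nonneg fun _ => by positivity
  have hT0 : 0 ≤ T := tsum_nonneg fun _ => by positivity
  have hgeom : ∀ k, ∫ x in Set.Ioi (0 : ℝ), ‖u k x‖ ^ 2 ≤ (R ^ 2) ^ k * J := by
    intro k
    induction k with
    | zero => simp [hJ]
    | succ k ih =>
      refine (hRu k).trans ?_
      calc _ ≤ R ^ 2 * ((R ^ 2) ^ k * J) := by gcongr
        _ = _ := by ring
  -- The sup norm of a derivative is bounded by the L² norms of that derivative and the next one,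
  -- hence the factor 1 + R².
  have hsup : ∀ x ∈ Set.Icc 0 L, ‖u Z.card x‖ ≤ R ^ (K + 1) * √((1 + R ^ 2) * J) := by
    intro x hx
    have h := norm_sq_le_integral_Ioi (hu Z.card) (hd _) (hd _) hx.1
    rw [hZcard] at h ⊢
    have h2 : ‖u (K + 1) x‖ ^ 2 ≤ (R ^ (K + 1)) ^ 2 * ((1 + R ^ 2) * J) := by
      calc _ ≤ _ := h
        _ ≤ (R ^ 2) ^ (K + 1) * J + (R ^ 2) ^ (K + 1 + 1) * J :=
            add_le_add (hgeom _) (hgeom _)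
        _ = _ := by ring
    rw [← Real.sqrt_sq (pow_nonneg hR (K + 1)), ← Real.sqrt_mul (by positivity)]
    exact Real.le_sqrt_of_sq_le h2
  -- One factor K + 1 is Cauchy-Schwarz over the nodes; the other compensates the weights, which are
  -- at least 1/(K+1).
  have hS : (∑ z ∈ Z, ‖u 0 z‖) ^ 2 ≤ (K + 1) ^ 2 * T := by
    calc (∑ z ∈ Z, ‖u 0 z‖) ^ 2 ≤ Z.card * ∑ z ∈ Z, ‖u 0 z‖ ^ 2 := sq_sum_le_card_mul_sum_sq
      _ = (K + 1) * ∑ n ∈ Finset.range (K + 1), ‖u 0 (Real.log (n + 1))‖ ^ 2 := by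
          rw [hZcard, hZdef, Finset.sum_image fun _ _ _ _ h => hinj h]; push_cast; ring
      _ ≤ (K + 1) * ((K + 1) * T) := by
          gcongr
          refine le_trans ?_ (mul_le_mul_of_nonneg_left
            (hsum.sum_le_tsum (Finset.range (K + 1)) fun _ _ => by positivity) (by positivity))
          rw [Finset.mul_sum]
          refine Finset.sum_le_sum fun n hn => ?_
          have : (n : ℝ) ≤ K := by exact_mod_cast Nat.lt_succ_iff.1 (Finset.mem_range.1 hn)
          rw [mul_div_assoc', le_div_iff₀ (by positivity), mul_comm]
          gcongr
      _ = _ := by ring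
  set δ := R ^ (K + 1) * (L ^ (K + 1) / ((K + 1).factorial : ℝ)) with hδ
  have hpt : ∀ x ∈ Set.Icc 0 L, ‖u 0 x‖ ^ 2
      ≤ 8 * (1 + R ^ 2) * δ ^ 2 * J + 8 * Λ ^ 2 * (K + 1) ^ 2 * T := by
    intro x hx
    have h := hΛ u _ hu hsup x hx
    rw [hZcard, sub_zero] at h
    set q := √((1 + R ^ 2) * J)
    have hq : q ^ 2 = (1 + R ^ 2) * J := Real.sq_sqrt (by positivity)
    set S := ∑ z ∈ Z, ‖u 0 z‖
    calc ‖u 0 x‖ ^ 2 ≤ (2 * (R ^ (K + 1) * q * (L ^ (K + 1) / ((K + 1).factorial : ℝ)))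
          + 2 * (Λ * S)) ^ 2 := by gcongr
      _ = (2 * (δ * q) + 2 * (Λ * S)) ^ 2 := by rw [hδ]; ring
      _ ≤ 8 * (δ ^ 2 * q ^ 2) + 8 * (Λ ^ 2 * S ^ 2) := by
          nlinarith [sq_nonneg (δ * q - Λ * S)]
      _ ≤ 8 * (δ ^ 2 * ((1 + R ^ 2) * J)) + 8 * (Λ ^ 2 * ((K + 1) ^ 2 * T)) := by
          rw [hq]; gcongr
      _ = _ := by ring
  have huc := (hd 0).continuous
  have hhead : ∫ x in (0 : ℝ)..L, ‖u 0 x‖ ^ 2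
      ≤ L * (8 * (1 + R ^ 2) * δ ^ 2 * J + 8 * Λ ^ 2 * (K + 1) ^ 2 * T) := by
    have := intervalIntegral.integral_mono_on hL0 ((huc.norm.pow 2).intervalIntegrable _ _)
      (intervalIntegrable_const (μ := volume) (a := 0) (b := L)) hpt
    rwa [intervalIntegral.integral_const, smul_eq_mul, sub_zero] at this
  have htail := integral_Ioi_log_le (hu 0) (hd 0) (hd 1) K hsum
  have h1 : ∫ t in Set.Ioi (0 : ℝ), ‖u (0 + 1) t‖ ^ 2 ≤ R ^ 2 * J := hRu 0
  rw [zero_add] at h1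
  have hsplit : J = (∫ x in (0 : ℝ)..L, ‖u 0 x‖ ^ 2) + ∫ x in Set.Ioi L, ‖u 0 x‖ ^ 2 :=
    (intervalIntegral.integral_interval_add_Ioi (hd 0).integrableOn_sq
      ((hd 0).integrableOn_sq.mono_set (Set.Ioi_subset_Ioi hL0))).symm
  have htail' : ∫ x in Set.Ioi L, ‖u 0 x‖ ^ 2 ≤ T + (1 + R ^ 2) / (K + 1) * J := by
    refine htail.trans ?_
    calc _ ≤ T + 1 / (K + 1) * (J + R ^ 2 * J) := by gcongr
      _ = _ := by ring
  have hfin : J ≤ (8 * L * (1 + R ^ 2) * δ ^ 2 + (1 + R ^ 2) / (K + 1)) * J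
      + (1 + 8 * L * Λ ^ 2 * (K + 1) ^ 2) * T := by
    linarith
  have := mul_le_mul_of_nonneg_right hK hJ0
  linarith

/-! ### Blaschke division and bounds for the functionals on nice functions -/

/-- Functions continuous on the closed right half-plane, holomorphic inside and
`O(1 / (1 + |z|))`. -/
structure HalfPlaneDecay (f : ℂ → ℂ) : Prop where
  cont : ContinuousOn f {z | 0 ≤ z.re}
  diff : DifferentiableOn ℂ f {z | 0 < z.re}
  bound : ∃ C, ∀ z : ℂ, 0 ≤ z.re → ‖f z‖ ≤ C / (1 + ‖z‖)

lemma isOpen_re_pos : IsOpen {z : ℂ | 0 < z.re} := isOpen_lt continuous_const continuous_re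

lemma continuous_comp_vertical {D : ℂ → ℂ} (hD : ContinuousOn D {z | 0 ≤ z.re}) :
    Continuous fun t : ℝ => D (t * I) :=
  hD.comp_continuous (by fun_prop) fun t => by simp

lemma one_add_norm_sq_ge (z : ℂ) : 1 + z.im ^ 2 ≤ (1 + ‖z‖) ^ 2 := by
  have := Complex.abs_im_le_norm z
  nlinarith [norm_nonneg z, sq_abs z.im, abs_nonneg z.im]

lemma integrable_of_quadratic_decay {D : ℂ → ℂ} {C : ℝ} (hD : ContinuousOn D {z | 0 ≤ z.re})
    (hC : ∀ z : ℂ, 0 ≤ z.re → ‖D z‖ ≤ C / (1 + ‖z‖) ^ 2) :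
    Integrable fun t : ℝ => D (t * I) := by
  refine Integrable.mono' (integrable_inv_one_add_sq.const_mul C)
    (continuous_comp_vertical hD).aestronglyMeasurable (Filter.Eventually.of_forall fun t => ?_)
  have hC0 : 0 ≤ C := by
    have := (norm_nonneg _).trans (hC 0 (by simp))
    simpa using this
  refine (hC (t * I) (by simp)).trans ?_
  rw [div_eq_mul_inv]
  have h := one_add_norm_sq_ge (t * I)
  simp only [mul_im, ofReal_re, I_im, mul_one, ofReal_im, I_re, mul_zero, add_zero] at h
  gcongr

/-- Cauchy's theorem on the right half-plane. -/
lemma integral_vertical_eq_zero {D : ℂ → ℂ} {C : ℝ} (hD : ContinuousOn D {z | 0 ≤ z.re})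
    (hd : DifferentiableOn ℂ D {z | 0 < z.re})
    (hC : ∀ z : ℂ, 0 ≤ z.re → ‖D z‖ ≤ C / (1 + ‖z‖) ^ 2) : ∫ t : ℝ, D (t * I) = 0 := by
  have hC0 : 0 ≤ C := by
    have := (norm_nonneg _).trans (hC 0 (by simp))
    simpa using this
  have hlim : Filter.Tendsto (fun T : ℝ => ∫ t in (-T)..T, D (t * I)) Filter.atTop
      (nhds (∫ t : ℝ, D (t * I))) :=
    intervalIntegral_tendsto_integral (integrable_of_quadratic_decay hD hC)
      Filter.tendsto_neg_atTop_atBot Filter.tendsto_id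
  refine tendsto_nhds_unique hlim (squeeze_zero_norm' (a := fun T : ℝ => 4 * C * T⁻¹) ?_ ?_)
  · filter_upwards [Filter.eventually_gt_atTop 0] with T hT
    -- On the rectangle [0,T] × [-T,T], the three sides off the imaginary axis have total length 4T
    -- and |D| ≤ C/T² there.
    have hrect := Complex.integral_boundary_rect_eq_zero_of_continuousOn_of_differentiableOn D
      ((0 : ℝ) + (-T : ℝ) * I) ((T : ℝ) + (T : ℝ) * I)
      (hD.mono fun z hz => by
        have := (mem_reProdIm.1 hz).1
        simp [Set.uIcc_of_le hT.le] at this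
        exact this.1)
      (hd.mono fun z hz => by
        have := (mem_reProdIm.1 hz).1
        simp [hT.le] at this
        exact this.1)
    simp only [add_re, ofReal_re, mul_re, I_re, mul_zero, ofReal_im, I_im, mul_one, sub_self,
      add_zero, add_im, mul_im, zero_add, ofReal_zero] at hrect
    simp only [ofReal_neg] at hrect
    have hbd : ∀ z : ℂ, 0 ≤ z.re → T ≤ ‖z‖ → ‖D z‖ ≤ C / T ^ 2 := fun z hz hTz =>
      (hC z hz).trans (by gcongr; linarith)
    have b1 : ‖∫ x in (0 : ℝ)..T, D (x + -(T : ℂ) * I)‖ ≤ C / T ^ 2 * |T - 0| := by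
      refine intervalIntegral.norm_integral_le_of_norm_le_const fun x hx => hbd _ ?_ ?_
      · rw [Set.uIoc_of_le hT.le] at hx; simp [hx.1.le]
      · have := Complex.abs_im_le_norm ((x : ℂ) + -(T : ℂ) * I)
        simpa [abs_of_pos hT] using this
    have b2 : ‖∫ x in (0 : ℝ)..T, D (x + (T : ℂ) * I)‖ ≤ C / T ^ 2 * |T - 0| := by
      refine intervalIntegral.norm_integral_le_of_norm_le_const fun x hx => hbd _ ?_ ?_
      · rw [Set.uIoc_of_le hT.le] at hx; simp [hx.1.le]
      · have := Complex.abs_im_le_norm ((x : ℂ) + (T : ℂ) * I)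
        simpa [abs_of_pos hT] using this
    have b3 : ‖∫ y in (-T)..T, D ((T : ℂ) + y * I)‖ ≤ C / T ^ 2 * |T - -T| := by
      refine intervalIntegral.norm_integral_le_of_norm_le_const fun x hx => hbd _ ?_ ?_
      · simp [hT.le]
      · have := Complex.abs_re_le_norm ((T : ℂ) + x * I)
        simpa [abs_of_pos hT] using this
    rw [sub_zero, abs_of_pos hT] at b1 b2
    rw [sub_neg_eq_add, abs_of_pos (by linarith)] at b3
    have heq : I • ∫ y in (-T)..T, D (y * I)
        = (∫ x in (0 : ℝ)..T, D (x + -(T : ℂ) * I)) - (∫ x in (0 : ℝ)..T, D (x + (T : ℂ) * I))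
          + I • ∫ y in (-T)..T, D ((T : ℂ) + y * I) := by
      rw [sub_eq_zero] at hrect
      exact hrect.symm
    have hn : ‖∫ y in (-T)..T, D (y * I)‖ = ‖I • ∫ y in (-T)..T, D (y * I)‖ := by
      rw [norm_smul, norm_I, one_mul]
    rw [hn, heq]
    refine (norm_add_le _ _).trans ?_
    rw [norm_smul, norm_I, one_mul]
    have := norm_sub_le (∫ x in (0 : ℝ)..T, D (x + -(T : ℂ) * I))
      (∫ x in (0 : ℝ)..T, D (x + (T : ℂ) * I))
    calc _ ≤ C / T ^ 2 * T + C / T ^ 2 * T + C / T ^ 2 * (T + T) := by linarith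
      _ = _ := by field_simp; ring
  · simpa using tendsto_inv_atTop_zero.const_mul (4 * C)

lemma integral_inv_norm_sq {a : ℂ} (ha : 0 < a.re) :
    (Integrable fun t : ℝ => (‖(t : ℂ) * I + (starRingEnd ℂ) a‖ ^ 2)⁻¹) ∧
      ∫ t : ℝ, (‖(t : ℂ) * I + (starRingEnd ℂ) a‖ ^ 2)⁻¹ = Real.pi / a.re := by
  have h : ∀ t : ℝ, (‖(t : ℂ) * I + (starRingEnd ℂ) a‖ ^ 2)⁻¹
      = (a.re ^ 2)⁻¹ * (1 + ((t - a.im) / a.re) ^ 2)⁻¹ := by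
    intro t
    rw [← Complex.normSq_eq_norm_sq, Complex.normSq_apply, ← mul_inv]
    congr 1
    simp
    field_simp
    ring
  simp_rw [h]
  constructor
  · exact (((integrable_inv_one_add_sq.comp_div ha.ne').comp_sub_right a.im)).const_mul _
  · rw [integral_const_mul, integral_sub_right_eq_self
      (fun t : ℝ => (1 + (t / a.re) ^ 2)⁻¹) a.im,
      Measure.integral_comp_div (fun t : ℝ => (1 + t ^ 2)⁻¹), integral_univ_inv_one_add_sq,
      abs_of_pos ha, smul_eq_mul]
    field_simp

namespace HalfPlaneDecay

variable {f : ℂ → ℂ}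

lemma integrable_sq (hf : HalfPlaneDecay f) : Integrable fun t : ℝ => ‖f (t * I)‖ ^ 2 := by
  obtain ⟨C, hC⟩ := hf.bound
  have h := integrable_of_quadratic_decay (D := fun z => f z * f z) (C := C ^ 2)
    (hf.cont.mul hf.cont) fun z hz => by
      rw [norm_mul, ← div_pow, ← sq]
      gcongr
      exact hC z hz
  refine h.norm.congr (Filter.Eventually.of_forall fun t => ?_)
  simp [sq]

lemma one_add_norm_le {a z : ℂ} (ha : 0 < a.re) (hz : 0 ≤ z.re) :
    1 + ‖z‖ ≤ (1 + (1 + ‖a‖) / a.re) * ‖z + (starRingEnd ℂ) a‖ := by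
  have h1 : a.re ≤ ‖z + (starRingEnd ℂ) a‖ := by
    refine le_trans ?_ (Complex.re_le_norm _)
    simp [hz]
  have h2 : ‖z‖ ≤ ‖z + (starRingEnd ℂ) a‖ + ‖a‖ := by
    have := norm_sub_le (z + (starRingEnd ℂ) a) ((starRingEnd ℂ) a)
    simpa using this
  have h3 : 1 + ‖a‖ ≤ (1 + ‖a‖) / a.re * ‖z + (starRingEnd ℂ) a‖ := by
    rw [div_mul_eq_mul_div, le_div_iff₀ ha]
    gcongr
  linarith

/-- Division by a Blaschke factor. -/
lemma exists_blaschke_quotient (hf : HalfPlaneDecay f) {a : ℂ} (ha : 0 < a.re) :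
    ∃ g, HalfPlaneDecay g ∧
      (∀ z, (z - a) * g z = (z + (starRingEnd ℂ) a) * f z - 2 * a.re * f a) ∧
      ∫ t : ℝ, ‖f (t * I)‖ ^ 2
        = 4 * Real.pi * a.re * ‖f a‖ ^ 2 + ∫ t : ℝ, ‖g (t * I)‖ ^ 2 := by
  set F : ℂ → ℂ := fun z => (z + (starRingEnd ℂ) a) * f z with hF
  have hFa : F a = 2 * a.re * f a := by
    rw [hF]; simp only; rw [Complex.add_conj]; push_cast; ring
  have hnhds : {z : ℂ | 0 < z.re} ∈ nhds a := isOpen_re_pos.mem_nhds ha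
  have hnhds' : {z : ℂ | 0 ≤ z.re} ∈ nhds a :=
    Filter.mem_of_superset hnhds fun z (hz : 0 < z.re) => hz.le
  have hFd : DifferentiableOn ℂ F {z | 0 < z.re} := (by fun_prop : Differentiable ℂ
    fun z => z + (starRingEnd ℂ) a).differentiableOn.mul hf.diff
  have hFc : ContinuousOn F {z | 0 ≤ z.re} :=
    (by fun_prop : Continuous fun z => z + (starRingEnd ℂ) a).continuousOn.mul hf.cont
  -- This gives f = 2 (Re a) f(a)/(z + conj a) + ((z - a)/(z + conj a)) g: a multiple of the
  -- reproducing kernel at a plus a multiple of the Blaschke factor, which is unimodular on the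
  -- imaginary axis.
  set g := dslope F a with hg
  have hgc : ContinuousOn g {z | 0 ≤ z.re} :=
    (continuousOn_dslope hnhds').2 ⟨hFc, hFd.differentiableAt hnhds⟩
  have hgd : DifferentiableOn ℂ g {z | 0 < z.re} := (Complex.differentiableOn_dslope hnhds).2 hFd
  have hid : ∀ z, (z - a) * g z = (z + (starRingEnd ℂ) a) * f z - 2 * a.re * f a := by
    intro z
    have := sub_smul_dslope F a z
    rw [smul_eq_mul, hFa] at this
    exact this
  have hgdec : HalfPlaneDecay g := by
    refine ⟨hgc, hgd, ?_⟩
    obtain ⟨C, hC⟩ := hf.bound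
    obtain ⟨M, hM⟩ := ((isCompact_closedBall a 1).inter_right
      (isClosed_le continuous_const continuous_re)).exists_bound_of_continuousOn
      (hgc.mono fun z hz => hz.2)
    have hC0 : 0 ≤ C := by
      have := (norm_nonneg _).trans (hC 0 (by simp))
      simpa using this
    set A := (1 + ‖a‖) * C + ‖2 * (a.re : ℂ) * f a‖ with hA
    have hA0 : 0 ≤ A := by positivity
    refine ⟨A * (2 + ‖a‖) + |M| * (2 + ‖a‖), fun z hz => ?_⟩
    rw [le_div_iff₀ (by positivity)]
    have hzn : ‖z‖ ≤ ‖z - a‖ + ‖a‖ := by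
      simpa using norm_add_le (z - a) a
    by_cases hza : ‖z - a‖ ≤ 1
    · have h1 : ‖g z‖ ≤ |M| :=
        (hM z ⟨by simpa [dist_eq_norm] using hza, hz⟩).trans (le_abs_self M)
      calc ‖g z‖ * (1 + ‖z‖) ≤ |M| * (2 + ‖a‖) :=
            mul_le_mul h1 (by linarith) (by positivity) (abs_nonneg M)
        _ ≤ _ := by linarith [mul_nonneg hA0 (by positivity : 0 ≤ 2 + ‖a‖)]
    · push Not at hza
      have h1 : ‖z - a‖ * ‖g z‖ ≤ A := by
        rw [← norm_mul, hid z]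
        refine (norm_sub_le _ _).trans ?_
        rw [hA]
        gcongr
        rw [norm_mul]
        have h2 : ‖z + (starRingEnd ℂ) a‖ ≤ (1 + ‖a‖) * (1 + ‖z‖) := by
          refine (norm_add_le _ _).trans ?_
          rw [RCLike.norm_conj]
          nlinarith [norm_nonneg a, norm_nonneg z]
        calc ‖z + (starRingEnd ℂ) a‖ * ‖f z‖ ≤ ((1 + ‖a‖) * (1 + ‖z‖)) * (C / (1 + ‖z‖)) := by
              gcongr; exact hC z hz
          _ = _ := by field_simp
      calc ‖g z‖ * (1 + ‖z‖) ≤ ‖g z‖ * ((2 + ‖a‖) * ‖z - a‖) := by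
            gcongr
            nlinarith [norm_nonneg a]
        _ = (‖z - a‖ * ‖g z‖) * (2 + ‖a‖) := by ring
        _ ≤ A * (2 + ‖a‖) := by gcongr
        _ ≤ _ := by linarith [mul_nonneg (abs_nonneg M) (by positivity : 0 ≤ 2 + ‖a‖)]
  refine ⟨g, hgdec, hid, ?_⟩
  have hne : ∀ z : ℂ, 0 ≤ z.re → z + (starRingEnd ℂ) a ≠ 0 := fun z hz h => by
    have := congrArg Complex.re h
    simp at this
    linarith
  -- On the imaginary axis conj(z + conj a) = -(z - a), so the inner product of the two summands
  -- reduces to a multiple of the integral of `D`. That integral is zero by Cauchy's theorem, so the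
  -- splitting is orthogonal.
  set D : ℂ → ℂ := fun z => g z / (z + (starRingEnd ℂ) a) with hDdef
  have hDc : ContinuousOn D {z | 0 ≤ z.re} :=
    hgc.div (by fun_prop) fun z hz => hne z hz
  have hDd : DifferentiableOn ℂ D {z | 0 < z.re} :=
    hgd.div (by fun_prop) fun z hz => hne z (le_of_lt hz)
  obtain ⟨C, hC⟩ := hgdec.bound
  have hC0 : 0 ≤ C := by
    have := (norm_nonneg _).trans (hC 0 (by simp))
    simpa using this
  have hDb : ∀ z : ℂ, 0 ≤ z.re → ‖D z‖ ≤ C * (1 + (1 + ‖a‖) / a.re) / (1 + ‖z‖) ^ 2 := by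
    intro z hz
    have hpos : 0 < ‖z + (starRingEnd ℂ) a‖ := norm_pos_iff.2 (hne z hz)
    rw [hDdef, norm_div, div_le_div_iff₀ hpos (by positivity)]
    have h1 := hC z hz
    rw [le_div_iff₀ (by positivity)] at h1
    calc ‖g z‖ * (1 + ‖z‖) ^ 2 = (‖g z‖ * (1 + ‖z‖)) * (1 + ‖z‖) := by ring
      _ ≤ C * ((1 + (1 + ‖a‖) / a.re) * ‖z + (starRingEnd ℂ) a‖) := by
          gcongr
          exact one_add_norm_le ha hz
      _ = _ := by ring
  have hD0 := integral_vertical_eq_zero hDc hDd hDb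
  have hDi := integrable_of_quadratic_decay hDc hDb
  obtain ⟨hEi, hE⟩ := integral_inv_norm_sq ha
  have hpt : ∀ t : ℝ, ‖f (t * I)‖ ^ 2
      = 4 * a.re ^ 2 * ‖f a‖ ^ 2 * (‖(t : ℂ) * I + (starRingEnd ℂ) a‖ ^ 2)⁻¹
        + ‖g (t * I)‖ ^ 2 - 4 * a.re * ((starRingEnd ℂ) (f a) * D (t * I)).re := by
    intro t
    have hE0 : (t : ℂ) * I + (starRingEnd ℂ) a ≠ 0 := hne _ (by simp)
    have hft : f (t * I) = (2 * a.re * f a + (t * I - a) * g (t * I))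
        / (t * I + (starRingEnd ℂ) a) := by
      rw [eq_div_iff hE0, hid]; ring
    have hgt : g (t * I) = D (t * I) * (t * I + (starRingEnd ℂ) a) := by
      rw [hDdef, div_mul_cancel₀ _ hE0]
    rw [hft, hgt]
    generalize D (t * I) = d
    generalize f a = w
    have hpos : (0 : ℝ) < ‖(t : ℂ) * I + (starRingEnd ℂ) a‖ ^ 2 := by positivity
    rw [norm_div, div_pow]
    have haux : ∀ A S Y Z : ℝ, S ≠ 0 → (A * S⁻¹ + Y - Z) * S = A + (Y - Z) * S := by
      intro A S Y Z hS; field_simp; ring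
    rw [div_eq_iff hpos.ne', haux _ _ _ _ hpos.ne']
    simp only [← Complex.normSq_eq_norm_sq, Complex.normSq_apply]
    simp
    ring
  simp_rw [hpt]
  have hi2 : Integrable fun t : ℝ => 4 * a.re * ((starRingEnd ℂ) (f a) * D (t * I)).re :=
    ((hDi.const_mul _).re).const_mul _
  have hre : ∫ t : ℝ, ((starRingEnd ℂ) (f a) * D (t * I)).re = 0 := by
    have := integral_re (hDi.const_mul ((starRingEnd ℂ) (f a)))
    rw [integral_const_mul, hD0] at this
    simpa using this
  have hsum : Integrable fun t : ℝ =>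
      4 * a.re ^ 2 * ‖f a‖ ^ 2 * (‖(t : ℂ) * I + (starRingEnd ℂ) a‖ ^ 2)⁻¹ + ‖g (t * I)‖ ^ 2 :=
    (hEi.const_mul _).add hgdec.integrable_sq
  rw [integral_sub hsum hi2,
    integral_add (hEi.const_mul _) hgdec.integrable_sq, integral_const_mul, integral_const_mul,
    hre, hE, mul_zero, sub_zero]
  congr 1
  field_simp

end HalfPlaneDecay

lemma closedBall_subset_re_pos {c : ℂ} {r : ℝ} (hrc : r < c.re) :
    Metric.closedBall c r ⊆ {z : ℂ | 0 < z.re} := fun _ hz => re_pos_of_mem_ball hrc hz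

lemma diffContOnCl_ball_of_differentiableOn {c : ℂ} {r : ℝ} (hrc : r < c.re)
    {f : ℂ → ℂ} (hf : DifferentiableOn ℂ f {z | 0 < z.re}) : DiffContOnCl ℂ f (Metric.ball c r) :=
  (hf.mono (closedBall_subset_re_pos hrc)).diffContOnCl_ball (Set.Subset.refl _)

/-- The functionals attached to `s` are bounded on `H²` by the `L²` norm of the exponential sum. -/
lemma norm_contourFunctional_sq_le {c : ℂ} {r : ℝ} (hr : 0 < r) (hrc : r < c.re) :
    ∀ s : Multiset ℂ, (∀ a ∈ s, a ∈ Metric.ball c r) → ∀ (q : Polynomial ℂ) (f : ℂ → ℂ),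
      HalfPlaneDecay f → ‖contourFunctional c r s q f‖ ^ 2
        ≤ (∫ t : ℝ, ‖f (t * I)‖ ^ 2) / (2 * Real.pi) * expSumNormSq c r s q := by
  intro s
  induction s using Multiset.induction_on with
  | empty =>
    intro hs q f hf
    rw [contourFunctional_zero_eq_zero hr q (diffContOnCl_ball_of_differentiableOn hrc hf.diff)]
    have h1 : 0 ≤ ∫ t : ℝ, ‖f (t * I)‖ ^ 2 := integral_nonneg fun _ => by positivity
    have h2 := expSumNormSq_nonneg (c := c) (r := r) (s := 0) q
    rw [norm_zero, zero_pow two_ne_zero]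
    positivity
  | cons a s ih =>
    intro hs q f hf
    have hs' : ∀ b ∈ s, b ∈ Metric.ball c r := fun b hb => hs b (Multiset.mem_cons_of_mem hb)
    have hre : ∀ b ∈ a ::ₘ s, 0 < b.re := fun b hb =>
      re_pos_of_mem_ball hrc (Metric.ball_subset_closedBall (hs b hb))
    have ha := hre a (Multiset.mem_cons_self a s)
    obtain ⟨p, b, hpq⟩ := exists_eq_neg_mul_add ha
      (fun b hb => hre b (Multiset.mem_cons_of_mem hb)) q
    obtain ⟨g, hg, hid, hnorm⟩ := hf.exists_blaschke_quotient ha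
    have hsph : Metric.sphere c r ⊆ {z : ℂ | 0 < z.re} :=
      Metric.sphere_subset_closedBall.trans (closedBall_subset_re_pos hrc)
    have hfs : ContinuousOn f (Metric.sphere c r) := hf.diff.continuousOn.mono hsph
    have hgs : ContinuousOn g (Metric.sphere c r) := hg.diff.continuousOn.mono hsph
    -- Replace (z + conj a) f by 2 (Re a) f(a) + (z - a) g. The constant is a multiple of exp(-z·0),
    -- so it produces the exponential sum at 0; the factor z - a cancels the new root. The bound
    -- then follows by Cauchy-Schwarz from the orthogonal splittings of f and of the exponential
    -- sum.
    have hval : contourFunctional c r (a ::ₘ s) q f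
        = -(2 * a.re * f a * expSum c r (a ::ₘ s) p 0 + contourFunctional c r s p g) := by
      rw [hpq, contourFunctional_add_left hr hs _ _ hfs,
        contourFunctional_rootPoly_eq_zero hr hs _
          (diffContOnCl_ball_of_differentiableOn hrc hf.diff), add_zero, contourFunctional_neg,
        contourFunctional_mul_left]
      have h1 : Set.EqOn (fun z => (Polynomial.X + Polynomial.C ((starRingEnd ℂ) a)).eval z * f z)
          (fun z => (2 * a.re * f a) * exp (-(z * (0 : ℝ)))
            + (Polynomial.X - Polynomial.C a).eval z * g z) (Metric.sphere c r) := fun z _ => by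
        simp [hid z]
      have hgs' : ContinuousOn (fun z => (Polynomial.X - Polynomial.C a).eval z * g z)
          (Metric.sphere c r) := (Polynomial.continuous _).continuousOn.mul hgs
      have hexp : ContinuousOn (fun z : ℂ => (2 * a.re * f a) * exp (-(z * (0 : ℝ))))
          (Metric.sphere c r) := by fun_prop
      rw [contourFunctional_congr hr p h1, contourFunctional_add_right hr hs p hexp hgs',
        contourFunctional_const_mul,
        ← contourFunctional_mul_left,
        contourFunctional_cons_mul hr (hs a (Multiset.mem_cons_self a s))]
      rfl
    rw [hval, norm_neg, expSumNormSq_cons hr hrc hs hpq, hnorm]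
    have hi := ih hs' p g hg
    have hN := expSumNormSq_nonneg (c := c) (r := r) (s := s) p
    have hJ0 : 0 ≤ ∫ t : ℝ, ‖g (t * I)‖ ^ 2 := integral_nonneg fun _ => by positivity
    set N := expSumNormSq c r s p
    set J := ∫ t : ℝ, ‖g (t * I)‖ ^ 2
    set x := a.re
    have h1 : ‖2 * x * f a * expSum c r (a ::ₘ s) p 0 + contourFunctional c r s p g‖
        ≤ 2 * x * (‖f a‖ * ‖expSum c r (a ::ₘ s) p 0‖) + ‖contourFunctional c r s p g‖ := by
      refine (norm_add_le _ _).trans (le_of_eq ?_)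
      rw [norm_mul, norm_mul, norm_mul, Complex.norm_real, Real.norm_of_nonneg ha.le]
      simp; ring
    set A := ‖f a‖
    set B := ‖expSum c r (a ::ₘ s) p 0‖
    set G := ‖contourFunctional c r s p g‖
    have hA : 0 ≤ A := norm_nonneg _
    have hB : 0 ≤ B := norm_nonneg _
    have hG : 0 ≤ G := norm_nonneg _
    set K := J / (2 * Real.pi) with hK
    have hK0 : 0 ≤ K := by positivity
    have h2 : 2 * (A * B * G) ≤ A ^ 2 * N + K * B ^ 2 := by
      have hs1 := Real.sq_sqrt hK0
      have hs2 := Real.sq_sqrt hN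
      have : G ≤ √K * √N := by
        rw [← Real.sqrt_mul hK0]
        exact Real.le_sqrt_of_sq_le hi
      nlinarith [sq_nonneg (√K * B - √N * A), mul_le_mul_of_nonneg_left this (mul_nonneg hA hB)]
    have hsplit : (4 * Real.pi * x * A ^ 2 + J) / (2 * Real.pi) = 2 * x * A ^ 2 + K := by
      rw [hK]; field_simp; ring
    rw [hsplit]
    calc _ ≤ (2 * x * (A * B) + G) ^ 2 := by gcongr
      _ = (2 * x) ^ 2 * (A * B) ^ 2 + 2 * x * (2 * (A * B * G)) + G ^ 2 := by ring
      _ ≤ (2 * x) ^ 2 * (A * B) ^ 2 + 2 * x * (A ^ 2 * N + K * B ^ 2) + K * N := by gcongr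
      _ = _ := by ring

/-! ### From nice functions to the whole Hardy space -/

/-- The mean value property of the holomorphic function f². The angle runs over (-π, π) to match
polar coordinates. -/
lemma enorm_sq_le_circle_lintegral {f : ℂ → ℂ} {w : ℂ} {r : ℝ} (hr : 0 < r)
    (hf : DiffContOnCl ℂ f (Metric.ball w r)) :
    ENNReal.ofReal (2 * Real.pi) * ‖f w‖ₑ ^ 2
      ≤ ∫⁻ θ in Set.Ioo (-Real.pi) Real.pi, ‖f (circleMap w r θ)‖ₑ ^ 2 := by
  have hf2 : DiffContOnCl ℂ (fun z => f z ^ 2) (Metric.ball w |r|) := by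
    rw [abs_of_pos hr]
    have := hf.smul hf
    simpa only [smul_eq_mul, sq] using this
  have hmean := hf2.circleAverage
  have hper : ∫ θ in (0 : ℝ)..2 * Real.pi, f (circleMap w r θ) ^ 2
      = ∫ θ in (-Real.pi)..Real.pi, f (circleMap w r θ) ^ 2 := by
    have hp : Function.Periodic (fun θ => f (circleMap w r θ) ^ 2) (2 * Real.pi) := fun θ => by
      simp only [periodic_circleMap w r θ]
    have := hp.intervalIntegral_add_eq 0 (-Real.pi)
    rw [zero_add, show -Real.pi + 2 * Real.pi = Real.pi by ring] at this
    exact this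
  rw [Real.circleAverage_def, hper] at hmean
  have hpi := Real.pi_pos
  have hval : ∫ θ in (-Real.pi)..Real.pi, f (circleMap w r θ) ^ 2 = (2 * Real.pi) • f w ^ 2 := by
    rw [← hmean, smul_smul, mul_inv_cancel₀ (by positivity), one_smul]
  calc ENNReal.ofReal (2 * Real.pi) * ‖f w‖ₑ ^ 2
      = ‖(2 * Real.pi) • f w ^ 2‖ₑ := by
        rw [enorm_smul, enorm_pow, Real.enorm_of_nonneg (by positivity)]
    _ ≤ ∫⁻ θ in Set.Ioc (-Real.pi) Real.pi, ‖f (circleMap w r θ) ^ 2‖ₑ := by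
        rw [← hval, intervalIntegral.integral_of_le (by linarith)]
        exact enorm_integral_le_lintegral_enorm _
    _ = _ := by
        rw [Measure.restrict_congr_set Ioo_ae_eq_Ioc]
        simp only [enorm_pow]

/-- Mean value inequality over an annulus. -/
lemma enorm_sq_le_area_lintegral {F : ℂ → ℂ} (hFm : Measurable F) {w : ℂ} {ρ : ℝ} (hρ : 0 < ρ)
    (hF : DifferentiableOn ℂ F (Metric.ball w ρ)) :
    ENNReal.ofReal (ρ / 2) * (ENNReal.ofReal (ρ / 2) * (ENNReal.ofReal (2 * Real.pi) * ‖F w‖ₑ ^ 2))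
      ≤ ∫⁻ z : ℂ, (Metric.ball (0 : ℂ) ρ).indicator (fun z => ‖F (w + z)‖ₑ ^ 2) z := by
  rw [← Complex.lintegral_comp_polarCoord_symm]
  set Φ : ℂ → ℝ≥0∞ := (Metric.ball (0 : ℂ) ρ).indicator (fun z => ‖F (w + z)‖ₑ ^ 2) with hΦ
  have hΦm : Measurable Φ := Measurable.indicator (by fun_prop) Metric.isOpen_ball.measurableSet
  have hsm : Measurable fun p : ℝ × ℝ => Complex.polarCoord.symm p := by
    simp only [Complex.polarCoord_symm_apply]; fun_prop
  have hm : Measurable fun p : ℝ × ℝ => ENNReal.ofReal p.1 • Φ (Complex.polarCoord.symm p) := by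
    simp only [smul_eq_mul]
    exact (ENNReal.measurable_ofReal.comp measurable_fst).mul (hΦm.comp hsm)
  -- Keeping only radii above ρ/2 bounds the polar Jacobian below by ρ/2; the other factor ρ/2 is
  -- the length of the radial interval.
  have hsub : Set.Ioo (ρ / 2) ρ ×ˢ Set.Ioo (-Real.pi) Real.pi ⊆ polarCoord.target := by
    rw [polarCoord_target]
    exact Set.prod_mono (fun r hr => (by positivity : (0 : ℝ) < ρ / 2).trans hr.1) subset_rfl
  refine le_trans ?_ (lintegral_mono_set hsub)
  rw [Measure.volume_eq_prod, ← Measure.prod_restrict, lintegral_prod _ hm.aemeasurable]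
  calc _ = ∫⁻ _ in Set.Ioo (ρ / 2) ρ,
        ENNReal.ofReal (ρ / 2) * (ENNReal.ofReal (2 * Real.pi) * ‖F w‖ₑ ^ 2) := by
        rw [setLIntegral_const, Real.volume_Ioo, mul_comm]
        congr 2; ring
    _ ≤ _ := by
        refine setLIntegral_mono' measurableSet_Ioo fun r hr => ?_
        have hr0 : 0 < r := (by positivity : (0 : ℝ) < ρ / 2).trans hr.1
        have h1 := enorm_sq_le_circle_lintegral (f := F) (w := w) hr0
          ((hF.mono (Metric.closedBall_subset_ball hr.2)).diffContOnCl_ball subset_rfl)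
        have h2 : ∀ θ : ℝ, ENNReal.ofReal r • Φ (Complex.polarCoord.symm (r, θ))
            = ENNReal.ofReal r * ‖F (circleMap w r θ)‖ₑ ^ 2 := by
          intro θ
          have hs : Complex.polarCoord.symm (r, θ) = circleMap 0 r θ := by
            rw [Complex.polarCoord_symm_apply, circleMap_zero, Complex.exp_mul_I]
            push_cast; ring
          have hmem : circleMap 0 r θ ∈ Metric.ball (0 : ℂ) ρ := by
            simp [abs_of_pos hr0, hr.2]
          rw [hs, hΦ, Set.indicator_of_mem hmem, smul_eq_mul]
          congr 4
          simp [circleMap]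
        simp_rw [h2]
        rw [lintegral_const_mul' _ _ ENNReal.ofReal_ne_top]
        exact mul_le_mul' (ENNReal.ofReal_le_ofReal hr.1.le) h1

/-- A function with uniformly bounded `L²` norms on vertical lines is bounded on `Re z ≥ ε`. -/
lemma exists_bound_of_lintegral_vertical_le {f : ℂ → ℂ} {A : ℝ≥0∞} (hA : A ≠ ∞)
    (hf : DifferentiableOn ℂ f {z | 0 < z.re})
    (hfA : ∀ σ : ℝ, 0 < σ → ∫⁻ t : ℝ, ‖f (σ + t * I)‖ₑ ^ 2 ≤ A) {ε : ℝ} (hε : 0 < ε) :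
    ∃ M : ℝ, ∀ z : ℂ, ε ≤ z.re → ‖f z‖ ≤ M := by
  classical
  set F : ℂ → ℂ := Set.piecewise {z : ℂ | 0 < z.re} f 0 with hFdef
  have hFm : Measurable F := hf.continuousOn.measurable_piecewise continuousOn_const
    isOpen_re_pos.measurableSet
  have hFf : Set.EqOn F f {z | 0 < z.re} := Set.piecewise_eqOn _ _ _
  set K : ℝ≥0∞ := ENNReal.ofReal (ε / 2) * (ENNReal.ofReal (ε / 2) * ENNReal.ofReal (2 * Real.pi))
    with hK
  have hK0 : K ≠ 0 := by
    have := Real.pi_pos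
    simp only [hK, ne_eq, mul_eq_zero, ENNReal.ofReal_eq_zero, not_or, not_le]
    exact ⟨by positivity, by positivity, by positivity⟩
  have hKt : K ≠ ∞ := by
    simp only [hK]
    exact ENNReal.mul_ne_top ENNReal.ofReal_ne_top
      (ENNReal.mul_ne_top ENNReal.ofReal_ne_top ENNReal.ofReal_ne_top)
  set M := ENNReal.ofReal (2 * ε) * A / K with hM
  have hMt : M ≠ ∞ := ENNReal.div_ne_top (ENNReal.mul_ne_top ENNReal.ofReal_ne_top hA) hK0
  have key : ∀ w : ℂ, ε ≤ w.re → ‖f w‖ₑ ^ 2 ≤ M := by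
    intro w hw
    have hball : Metric.ball w ε ⊆ {z : ℂ | 0 < z.re} := by
      intro z hz
      have h1 : ‖z - w‖ < ε := by simpa [dist_eq_norm] using hz
      have h2 := (Complex.abs_re_le_norm (z - w)).trans_lt h1
      rw [abs_lt, sub_re] at h2
      show 0 < z.re
      linarith [h2.1]
    have h := enorm_sq_le_area_lintegral hFm hε ((hf.mono hball).congr fun z hz => hFf (hball hz))
    have hFw : F w = f w := hFf (show 0 < w.re by linarith)
    rw [hFw, ← mul_assoc, ← mul_assoc, mul_assoc (ENNReal.ofReal (ε / 2)), ← hK] at h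
    rw [hM, ENNReal.le_div_iff_mul_le (Or.inl hK0) (Or.inl hKt), mul_comm]
    refine h.trans ?_
    rw [← (Complex.volume_preserving_equiv_real_prod.symm).lintegral_comp_emb
      Complex.measurableEquivRealProd.symm.measurableEmbedding, Measure.volume_eq_prod]
    refine (lintegral_prod_le _).trans ?_
    -- The disc lies in a vertical strip of width 2ε, each line of which contributes at most `A`.
    have hx : ∀ x : ℝ, ∫⁻ y : ℝ, (Metric.ball (0 : ℂ) ε).indicator (fun z => ‖F (w + z)‖ₑ ^ 2)
        (Complex.measurableEquivRealProd.symm (x, y))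
          ≤ (Set.Ioo (-ε) ε).indicator (fun _ => A) x := by
      intro x
      by_cases hxε : x ∈ Set.Ioo (-ε) ε
      · rw [Set.indicator_of_mem hxε]
        have hσ : 0 < w.re + x := by linarith [hxε.1]
        calc _ ≤ ∫⁻ y : ℝ, ‖f (((w.re + x : ℝ) : ℂ) + ((w.im + y : ℝ) : ℂ) * I)‖ₑ ^ 2 := by
              refine lintegral_mono fun y => ?_
              refine (Set.indicator_le_self _ _ _).trans (le_of_eq ?_)
              have e : w + Complex.measurableEquivRealProd.symm (x, y)
                  = ((w.re + x : ℝ) : ℂ) + ((w.im + y : ℝ) : ℂ) * I := by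
                apply Complex.ext <;> simp [Complex.measurableEquivRealProd_symm_apply]
              rw [e, hFf]
              simpa using hσ
          _ = ∫⁻ y : ℝ, ‖f (((w.re + x : ℝ) : ℂ) + (y : ℂ) * I)‖ₑ ^ 2 :=
              lintegral_add_left_eq_self
                (fun y : ℝ => ‖f (((w.re + x : ℝ) : ℂ) + (y : ℂ) * I)‖ₑ ^ 2) w.im
          _ ≤ A := hfA _ hσ
      · rw [Set.indicator_of_notMem hxε, nonpos_iff_eq_zero]
        refine (lintegral_congr fun y => ?_).trans lintegral_zero
        refine Set.indicator_of_notMem (fun hmem => hxε ?_) _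
        have h1 := (Complex.abs_re_le_norm _).trans_lt (mem_ball_zero_iff.1 hmem)
        have h2 := abs_lt.1 h1
        simpa [Complex.measurableEquivRealProd_symm_apply] using h2
    refine (lintegral_mono hx).trans ?_
    rw [lintegral_indicator measurableSet_Ioo, setLIntegral_const, Real.volume_Ioo, mul_comm]
    gcongr
    linarith
  refine ⟨√M.toReal, fun z hz => Real.le_sqrt_of_sq_le ?_⟩
  have := ENNReal.toReal_mono hMt (key z hz)
  simpa using this

lemma one_add_norm_le_norm_one_add_mul {ε : ℝ} (hε : 0 < ε) (hε1 : ε ≤ 1) {z : ℂ}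
    (hz : 0 ≤ z.re) : ε / 2 * (1 + ‖z‖) ≤ ‖1 + (ε : ℂ) * z‖ := by
  have h1 : 1 ≤ ‖1 + (ε : ℂ) * z‖ := by
    refine le_trans ?_ (Complex.re_le_norm _)
    simp; positivity
  have h2 : ε * ‖z‖ ≤ ‖1 + (ε : ℂ) * z‖ := by
    refine le_of_sq_le_sq ?_ (norm_nonneg _)
    rw [mul_pow]
    simp only [← Complex.normSq_eq_norm_sq, Complex.normSq_apply]
    simp
    nlinarith [mul_nonneg hε.le hz]
  nlinarith

section Bound

variable {f : ℂ → ℂ} {A : ℝ≥0∞}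

/-- The shift makes f bounded and continuous up to the imaginary axis; the denominator supplies the
decay 1/|z|. Its modulus is at least 1, so the L² norm does not grow. -/
lemma halfPlaneDecay_regularize (hA : A ≠ ∞) (hf : DifferentiableOn ℂ f {z | 0 < z.re})
    (hfA : ∀ σ : ℝ, 0 < σ → ∫⁻ t : ℝ, ‖f (σ + t * I)‖ₑ ^ 2 ≤ A)
    {ε : ℝ} (hε : 0 < ε) (hε1 : ε ≤ 1) :
    HalfPlaneDecay (fun z => f (z + |ε|) / (1 + |ε| * z)) := by
  rw [abs_of_pos hε]
  obtain ⟨M, hM⟩ := exists_bound_of_lintegral_vertical_le hA hf hfA hε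
  have hmaps : Set.MapsTo (fun z : ℂ => z + (ε : ℂ)) {z | 0 ≤ z.re} {z | 0 < z.re} :=
    fun z (hz : 0 ≤ z.re) => by simp; linarith
  have hne : ∀ z : ℂ, 0 ≤ z.re → 1 + (ε : ℂ) * z ≠ 0 := fun z hz h => by
    have := one_add_norm_le_norm_one_add_mul hε hε1 hz
    rw [h, norm_zero] at this
    have : 0 < ε / 2 * (1 + ‖z‖) := by positivity
    linarith
  refine ⟨?_, ?_, M * (2 / ε), fun z hz => ?_⟩
  · exact (hf.continuousOn.comp (by fun_prop) hmaps).div (by fun_prop) fun z hz => hne z hz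
  · refine DifferentiableOn.div (hf.comp (by fun_prop) ?_) (by fun_prop)
      fun z (hz : 0 < z.re) => hne z hz.le
    exact fun z (hz : 0 < z.re) => hmaps hz.le
  · have h1 := one_add_norm_le_norm_one_add_mul hε hε1 hz
    have h2 := hM (z + ε) (by simp [hz])
    rw [norm_div, div_le_div_iff₀ (norm_pos_iff.2 (hne z hz)) (by positivity)]
    calc ‖f (z + ε)‖ * (1 + ‖z‖) ≤ M * (1 + ‖z‖) := by gcongr
      _ = M * (2 / ε) * (ε / 2 * (1 + ‖z‖)) := by field_simp
      _ ≤ _ := by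
        have : 0 ≤ M := (norm_nonneg _).trans h2
        gcongr

lemma integral_regularize_le (hA : A ≠ ∞) (hf : DifferentiableOn ℂ f {z | 0 < z.re})
    (hfA : ∀ σ : ℝ, 0 < σ → ∫⁻ t : ℝ, ‖f (σ + t * I)‖ₑ ^ 2 ≤ A)
    {ε : ℝ} (hε : 0 < ε) (hε1 : ε ≤ 1) :
    ∫ t : ℝ, ‖f (t * I + |ε|) / (1 + |ε| * (t * I))‖ ^ 2 ≤ A.toReal := by
  have hint := (halfPlaneDecay_regularize hA hf hfA hε hε1).integrable_sq
  rw [integral_eq_lintegral_of_nonneg_ae (Filter.Eventually.of_forall fun _ => by positivity)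
    hint.aestronglyMeasurable]
  refine ENNReal.toReal_mono hA (le_trans (lintegral_mono fun t => ?_) (hfA ε hε))
  rw [abs_of_pos hε, ENNReal.ofReal_pow (norm_nonneg _), ofReal_norm]
  have h1 : 1 ≤ ‖1 + (ε : ℂ) * (t * I)‖ := by
    refine le_trans ?_ (Complex.re_le_norm _)
    simp
  have h2 : ‖f (t * I + ε) / (1 + (ε : ℂ) * (t * I))‖ ≤ ‖f (ε + t * I)‖ := by
    rw [norm_div, add_comm ((t : ℂ) * I)]
    exact div_le_self (norm_nonneg _) h1
  gcongr
  exact enorm_le_iff_norm_le.2 h2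

/-- Boundedness of the functionals attached to `s` on the Hardy space of the half-plane. -/
lemma norm_contourFunctional_sq_le_of_hardy (hA : A ≠ ∞) (hf : DifferentiableOn ℂ f {z | 0 < z.re})
    (hfA : ∀ σ : ℝ, 0 < σ → ∫⁻ t : ℝ, ‖f (σ + t * I)‖ₑ ^ 2 ≤ A)
    {c : ℂ} {r : ℝ} (hr : 0 < r) (hrc : r < c.re)
    {s : Multiset ℂ} (hs : ∀ a ∈ s, a ∈ Metric.ball c r) (q : Polynomial ℂ) :
    ‖contourFunctional c r s q f‖ ^ 2 ≤ A.toReal / (2 * Real.pi) * expSumNormSq c r s q := by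
  -- The absolute value keeps the family defined and continuous for all real ε, so the limit ε → 0+
  -- is a value of a continuous function.
  set Λ : ℝ → ℂ := fun ε => contourFunctional c r s q fun z => f (z + |ε|) / (1 + |ε| * z) with hΛ
  have hmem : ∀ θ : ℝ, 0 < (circleMap c r θ).re := fun θ =>
    re_pos_of_mem_ball hrc (Metric.sphere_subset_closedBall (circleMap_mem_sphere c hr.le θ))
  have hcont : Continuous Λ := by
    have h1 : Continuous fun p : ℝ × ℝ => f (circleMap c r p.2 + (|p.1| : ℝ)) :=
      hf.continuousOn.comp_continuous (by fun_prop) fun p => by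
        have := hmem p.2
        simp only [Set.mem_ofPred_eq, add_re, ofReal_re]
        positivity
    have h2 : Continuous fun p : ℝ × ℝ => 1 + ((|p.1| : ℝ) : ℂ) * circleMap c r p.2 := by fun_prop
    have h3 : ∀ p : ℝ × ℝ, 1 + ((|p.1| : ℝ) : ℂ) * circleMap c r p.2 ≠ 0 := fun p h => by
      have h0 := congrArg Complex.re h
      have := hmem p.2
      simp only [add_re, one_re, re_ofReal_mul, zero_re] at h0
      have : 0 ≤ |p.1| * (circleMap c r p.2).re := by positivity
      linarith
    have h4 : Continuous fun p : ℝ × ℝ =>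
        q.eval (circleMap c r p.2) / (rootPoly s).eval (circleMap c r p.2) :=
      (continuousOn_ratio hs q).comp_continuous (by fun_prop)
        fun p => circleMap_mem_sphere c hr.le p.2
    have h5 : Continuous fun p : ℝ × ℝ => deriv (circleMap c r) p.2 := by
      simp only [deriv_circleMap]; fun_prop
    refine continuous_const.mul ?_
    simp only [circleIntegral]
    exact intervalIntegral.continuous_parametric_intervalIntegral_of_continuous'
      (h5.smul ((h1.div h2 h3).mul h4)) _ _
  have h0 : Λ 0 = contourFunctional c r s q f := by simp [hΛ]
  have hlim : Filter.Tendsto (fun ε => ‖Λ ε‖ ^ 2) (nhdsWithin 0 (Set.Ioi 0))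
      (nhds (‖contourFunctional c r s q f‖ ^ 2)) := by
    rw [← h0]
    exact ((hcont.norm.pow 2).tendsto 0).mono_left nhdsWithin_le_nhds
  refine le_of_tendsto hlim ?_
  filter_upwards [Ioo_mem_nhdsGT (one_pos : (0 : ℝ) < 1)] with ε hε
  refine (norm_contourFunctional_sq_le hr hrc s hs q _
    (halfPlaneDecay_regularize hA hf hfA hε.1 hε.2.le)).trans ?_
  have := expSumNormSq_nonneg (c := c) (r := r) (s := s) q
  have := Real.pi_pos
  gcongr
  exact integral_regularize_le hA hf hfA hε.1 hε.2.le

end Bound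

/-! ### Duality between samples and Dirichlet series -/

lemma ExpDecay.summable_sample {g : ℝ → ℂ} (hg : ExpDecay g) :
    Summable fun n : ℕ => ‖g (Real.log (n + 1))‖ ^ 2 / (n + 1) := by
  obtain ⟨K, δ, hδ, hK⟩ := hg.bound
  have hs : Summable fun n : ℕ => K ^ 2 * (((n + 1 : ℕ) : ℝ) ^ (-(1 + 2 * δ))) :=
    ((summable_nat_add_iff 1).2 (Real.summable_nat_rpow.2 (by linarith))).mul_left _
  refine Summable.of_nonneg_of_le (fun n => by positivity) (fun n => ?_) hs
  have hn : (0 : ℝ) < n + 1 := by positivity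
  have hlog : 0 ≤ Real.log (n + 1) :=
    Real.log_nonneg (by linarith [(Nat.cast_nonneg n : (0 : ℝ) ≤ n)])
  have h := hK _ hlog
  rw [div_le_iff₀ hn]
  calc ‖g (Real.log (n + 1))‖ ^ 2 ≤ (K * Real.exp (-(δ * Real.log (n + 1)))) ^ 2 := by gcongr
    _ = K ^ 2 * Real.exp (Real.log (n + 1) * (-(2 * δ))) := by
        rw [mul_pow, ← Real.exp_nat_mul]; congr 2; push_cast; ring
    _ = K ^ 2 * ((n + 1 : ℝ) ^ (-(1 + 2 * δ)) * (n + 1)) := by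
        rw [← Real.rpow_def_of_pos hn]
        nth_rewrite 3 [← Real.rpow_one ((n : ℝ) + 1)]
        rw [← Real.rpow_add hn]
        congr 2; ring
    _ = _ := by push_cast; ring

lemma lp_two_norm_sq (y : lp (fun _ : ℕ => ℂ) 2) : ‖y‖ ^ 2 = ∑' n, ‖y n‖ ^ 2 := by
  have := lp.norm_rpow_eq_tsum (p := 2) (by norm_num) y
  simpa using this

lemma lp_two_summable (y : lp (fun _ : ℕ => ℂ) 2) : Summable fun n => ‖y n‖ ^ 2 := by
  have := (lp.memℓp y).summable (by norm_num)
  simpa using this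

/-- The weighted samples of `g` at `log (n + 1)`. -/
noncomputable def logSample (g : ℝ → ℂ) (n : ℕ) : ℂ := ((√((n : ℝ) + 1))⁻¹ : ℝ) * g (Real.log (n + 1))

lemma norm_logSample_sq (g : ℝ → ℂ) (n : ℕ) :
    ‖logSample g n‖ ^ 2 = ‖g (Real.log (n + 1))‖ ^ 2 / (n + 1) := by
  rw [logSample, norm_mul, mul_pow, Complex.norm_real, Real.norm_eq_abs, sq_abs, inv_pow,
    Real.sq_sqrt (by positivity)]
  ring

lemma ExpDecay.memℓp_logSample {g : ℝ → ℂ} (hg : ExpDecay g) : Memℓp (logSample g) 2 := by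
  refine memℓp_gen ?_
  simpa [norm_logSample_sq] using hg.summable_sample

section Sample

variable {c : ℂ} {r : ℝ} {s : Multiset ℂ}

/-- The map sending `q` to the samples of the exponential sum it defines. -/
noncomputable def sampleMap (hr : 0 < r) (hrc : r < c.re) (hs : ∀ a ∈ s, a ∈ Metric.ball c r) :
    Polynomial ℂ →ₗ[ℂ] lp (fun _ : ℕ => ℂ) 2 where
  toFun q := ⟨logSample (expSum c r s q), (expDecay_expSum hr hrc hs q).memℓp_logSample⟩
  map_add' p q := by
    ext n
    simp only [logSample, expSum_add hr hs, lp.coeFn_add, Pi.add_apply]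
    ring
  map_smul' b q := by
    ext n
    have : expSum c r s (b • q) (Real.log (n + 1)) = b * expSum c r s q (Real.log (n + 1)) := by
      rw [Polynomial.smul_eq_C_mul]; exact contourFunctional_C_mul _ _ _
    simp only [logSample, this, lp.coeFn_smul, Pi.smul_apply, RingHom.id_apply, smul_eq_mul]
    ring

lemma sampleMap_apply (hr : 0 < r) (hrc : r < c.re) (hs : ∀ a ∈ s, a ∈ Metric.ball c r)
    (q : Polynomial ℂ) (n : ℕ) :
    sampleMap hr hrc hs q n = logSample (expSum c r s q) n := rfl

lemma norm_sampleMap_sq (hr : 0 < r) (hrc : r < c.re) (hs : ∀ a ∈ s, a ∈ Metric.ball c r)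
    (q : Polynomial ℂ) : ‖sampleMap hr hrc hs q‖ ^ 2
      = ∑' n : ℕ, ‖expSum c r s q (Real.log (n + 1))‖ ^ 2 / (n + 1) := by
  rw [lp_two_norm_sq]
  simp only [sampleMap_apply, norm_logSample_sq]

/-- The functional `q ↦ contourFunctional c r s q f` as a linear map. -/
noncomputable def contourLinearMap (hr : 0 < r) (hs : ∀ a ∈ s, a ∈ Metric.ball c r) {f : ℂ → ℂ}
    (hf : ContinuousOn f (Metric.sphere c r)) : Polynomial ℂ →ₗ[ℂ] ℂ where
  toFun q := contourFunctional c r s q f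
  map_add' p q := contourFunctional_add_left hr hs p q hf
  map_smul' b q := by
    rw [Polynomial.smul_eq_C_mul]; exact contourFunctional_C_mul _ _ _

end Sample

/-- Lower frame bound for samples of exponential sums, uniform in the exponents. -/
lemma exists_expSumNormSq_le (R : ℝ) (hR : 0 ≤ R) : ∃ C : ℝ, 0 < C ∧
    ∀ (c : ℂ) (r : ℝ) (s : Multiset ℂ) (M : ℝ) (hr : 0 < r) (hrc : r < c.re)
      (hs : ∀ a ∈ s, a ∈ Metric.ball c r), 0 ≤ M → (∀ a ∈ s, ‖a‖ ≤ M) → M + reSum s ≤ R →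
      ∀ q, expSumNormSq c r s q ≤ C * ‖sampleMap hr hrc hs q‖ ^ 2 := by
  obtain ⟨C, hC, h⟩ := exists_integral_norm_sq_le_tsum R hR
  refine ⟨C, hC, fun c r s M hr hrc hs hM hsM hMR q => ?_⟩
  have hX := reSum_nonneg hrc hs
  -- The k-th derivative is again an exponential sum over the same exponents, so the Bernstein
  -- inequality applies at every order with the same constant.
  have := h (fun k => expSum c r s ((-Polynomial.X) ^ k * q))
    (fun k x => by
      have e : (-Polynomial.X) ^ (k + 1) * q = -(Polynomial.X * ((-Polynomial.X) ^ k * q)) := by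
        ring
      rw [e]
      exact hasDerivAt_expSum hr hs _ x)
    (fun k => expDecay_expSum hr hrc hs _)
    (fun k => by
      have e : (-Polynomial.X) ^ (k + 1) * q = -(Polynomial.X * ((-Polynomial.X) ^ k * q)) := by
        ring
      rw [e]
      refine (expSumNormSq_X_mul_le hr hrc hM s hs hsM _).trans ?_
      have := expSumNormSq_nonneg (c := c) (r := r) (s := s) ((-Polynomial.X) ^ k * q)
      exact mul_le_mul_of_nonneg_right (by gcongr) this)
    (by simpa using (expDecay_expSum hr hrc hs q).summable_sample)
  rw [norm_sampleMap_sq]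
  simpa [expSumNormSq] using this

/-- A linear functional dominated by `‖T v‖` factors through `T` with the same bound. -/
lemma exists_dual_comp_eq {V E : Type*} [AddCommGroup V] [Module ℂ V] [NormedAddCommGroup E]
    [NormedSpace ℂ E] (T : V →ₗ[ℂ] E) (Λ : V →ₗ[ℂ] ℂ) {C : ℝ} (hC : 0 ≤ C)
    (h : ∀ v, ‖Λ v‖ ≤ C * ‖T v‖) :
    ∃ φ : StrongDual ℂ E, ‖φ‖ ≤ C ∧ ∀ v, φ (T v) = Λ v := by
  have hker : LinearMap.ker T ≤ LinearMap.ker Λ := fun v hv => by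
    have := h v
    rw [LinearMap.mem_ker] at hv ⊢
    rw [hv, norm_zero, mul_zero] at this
    exact norm_le_zero_iff.1 this
  set ψ : LinearMap.range T →ₗ[ℂ] ℂ :=
    ((LinearMap.ker T).liftQ Λ hker) ∘ₗ (T.quotKerEquivRange.symm : _ →ₗ[ℂ] _) with hψ
  have hψT : ∀ v, ψ ⟨T v, LinearMap.mem_range_self T v⟩ = Λ v := fun v => by
    have : T.quotKerEquivRange.symm ⟨T v, LinearMap.mem_range_self T v⟩
        = (LinearMap.ker T).mkQ v := T.quotKerEquivRange_symm_apply_image v _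
    simp only [hψ, LinearMap.comp_apply, LinearEquiv.coe_coe, this]
    simp
  have hb : ∀ y, ‖ψ y‖ ≤ C * ‖y‖ := by
    rintro ⟨_, v, rfl⟩
    rw [hψT]
    exact h v
  obtain ⟨φ, hφ, hφn⟩ := exists_extension_norm_eq (LinearMap.range T) (ψ.mkContinuous C hb)
  refine ⟨φ, hφn ▸ ψ.mkContinuous_norm_le hC hb, fun v => ?_⟩
  rw [← hψT v]
  exact hφ ⟨T v, LinearMap.mem_range_self T v⟩

/-- Contour functionals commute with uniformly summable series. -/
lemma hasSum_contourFunctional {c : ℂ} {r : ℝ} {s : Multiset ℂ} (hr : 0 < r)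
    (hs : ∀ a ∈ s, a ∈ Metric.ball c r) (q : Polynomial ℂ) {h : ℕ → ℂ → ℂ} {H : ℂ → ℂ}
    {b : ℕ → ℝ} (hb : Summable b) (hc : ∀ n, ContinuousOn (h n) (Metric.sphere c r))
    (hle : ∀ n, ∀ z ∈ Metric.sphere c r, ‖h n z‖ ≤ b n)
    (hH : ∀ z ∈ Metric.sphere c r, HasSum (fun n => h n z) (H z)) :
    HasSum (fun n => contourFunctional c r s q (h n)) (contourFunctional c r s q H) := by
  have hrat := continuousOn_ratio hs q
  obtain ⟨M, hM⟩ := (isCompact_sphere c r).exists_bound_of_continuousOn hrat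
  have hmem : ∀ θ : ℝ, circleMap c r θ ∈ Metric.sphere c r := circleMap_mem_sphere c hr.le
  have hb0 : ∀ n, 0 ≤ b n := fun n => (norm_nonneg _).trans (hle n _ (hmem 0))
  refine HasSum.mul_left _ ?_
  simp only [circleIntegral]
  refine intervalIntegral.hasSum_integral_of_dominated_convergence
    (fun n _ => r * (b n * M)) (fun n => ?_) (fun n => ?_) ?_ ?_ ?_
  · refine Continuous.aestronglyMeasurable ?_
    have h1 : Continuous fun θ => h n (circleMap c r θ) *
        (q.eval (circleMap c r θ) / (rootPoly s).eval (circleMap c r θ)) :=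
      ((hc n).mul hrat).comp_continuous (continuous_circleMap c r) hmem
    simp only [deriv_circleMap]
    fun_prop
  · refine Filter.Eventually.of_forall fun θ _ => ?_
    rw [norm_smul, norm_mul]
    simp only [deriv_circleMap, norm_mul, norm_circleMap_zero, norm_I, mul_one, abs_of_pos hr]
    have h1 := hle n _ (hmem θ)
    have h2 := hM _ (hmem θ)
    have h3 := hb0 n
    gcongr
  · exact Filter.Eventually.of_forall fun θ _ => (hb.mul_right M).mul_left r
  · exact intervalIntegrable_const
  · exact Filter.Eventually.of_forall fun θ _ => ((hH _ (hmem θ)).mul_right _).const_smul _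

/-- The Dirichlet coefficients attached to a square-summable sequence; index `n + 1` carries the
conjugate of the `n`-th term. -/
noncomputable def dirichletCoeff (v : lp (fun _ : ℕ => ℂ) 2) : ℕ → ℂ
  | 0 => 0
  | n + 1 => (starRingEnd ℂ) (v n)

lemma summable_dirichletCoeff_sq (v : lp (fun _ : ℕ => ℂ) 2) :
    Summable fun n => ‖dirichletCoeff v n‖ ^ 2 := by
  refine (summable_nat_add_iff 1).1 ?_
  simpa [dirichletCoeff] using lp_two_summable v

lemma lSeriesSummable_of_summable_sq {a : ℕ → ℂ} (ha : Summable fun n => ‖a n‖ ^ 2) {s : ℂ}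
    (hs : 1 / 2 < s.re) : LSeriesSummable a s := by
  have h2 : Summable fun n : ℕ => (n : ℝ) ^ (-(2 * s.re)) :=
    Real.summable_nat_rpow.2 (by linarith)
  refine Summable.of_norm_bounded (ha.add h2) fun n => ?_
  rw [LSeries.norm_term_eq]
  split_ifs with hn
  · positivity
  · have hn0 : (0 : ℝ) < n := by exact_mod_cast Nat.pos_of_ne_zero hn
    have e : (n : ℝ) ^ (-(2 * s.re)) = ((n : ℝ) ^ (-s.re)) ^ 2 := by
      rw [← Real.rpow_natCast, ← Real.rpow_mul hn0.le]; congr 1; push_cast; ring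
    rw [e, div_eq_mul_inv, ← Real.rpow_neg hn0.le]
    nlinarith [sq_nonneg (‖a n‖ - (n : ℝ) ^ (-s.re)), sq_nonneg (‖a n‖),
      sq_nonneg ((n : ℝ) ^ (-s.re))]

lemma differentiableOn_lSeries_of_summable_sq {a : ℕ → ℂ} (ha : Summable fun n => ‖a n‖ ^ 2) :
    DifferentiableOn ℂ (LSeries a) halfPlane := by
  refine (LSeries_differentiableOn a).mono fun s (hs : 1 / 2 < s.re) => ?_
  have h : LSeries.abscissaOfAbsConv a ≤ ((1 / 2 : ℝ) : EReal) :=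
    LSeries.abscissaOfAbsConv_le_of_forall_lt_LSeriesSummable fun y hy =>
      lSeriesSummable_of_summable_sq ha (by simpa using hy)
  exact h.trans_lt (by exact_mod_cast hs)

/-- The translation by 1/2 produces the weight (n+1)^(-1/2) of `logSample`, leaving a pure
exponential in z. -/
lemma term_dirichletCoeff (v : lp (fun _ : ℕ => ℂ) 2) (z : ℂ) (n : ℕ) :
    LSeries.term (dirichletCoeff v) (z + 1 / 2) (n + 1)
      = ((√((n : ℝ) + 1))⁻¹ : ℝ) * (starRingEnd ℂ) (v n) * exp (-(z * Real.log (n + 1))) := by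
  have hn : (0 : ℝ) < (n : ℝ) + 1 := by positivity
  have hne : ((n + 1 : ℕ) : ℂ) ≠ 0 := by exact_mod_cast Nat.succ_ne_zero n
  rw [LSeries.term_of_ne_zero (Nat.succ_ne_zero n), dirichletCoeff, div_eq_mul_inv,
    ← Complex.cpow_neg, neg_add, Complex.cpow_add _ _ hne]
  have h1 : ((n + 1 : ℕ) : ℂ) ^ (-(1 / 2) : ℂ) = ((√((n : ℝ) + 1))⁻¹ : ℝ) := by
    rw [Real.sqrt_eq_rpow, ← Real.rpow_neg hn.le, Complex.ofReal_cpow hn.le]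
    push_cast; rfl
  have h2 : ((n + 1 : ℕ) : ℂ) ^ (-z) = exp (-(z * Real.log (n + 1))) := by
    rw [Complex.cpow_def_of_ne_zero hne, Complex.ofReal_log hn.le]
    push_cast; congr 1; ring
  rw [h1, h2]; ring

lemma norm_exp_neg_mul_log_le {z : ℂ} {δ : ℝ} (hz : δ ≤ z.re) (n : ℕ) :
    ‖exp (-(z * Real.log (n + 1)))‖ ≤ ((n + 1 : ℕ) : ℝ) ^ (-δ) := by
  have hlog : 0 ≤ Real.log (n + 1) :=
    Real.log_nonneg (by linarith [(Nat.cast_nonneg n : (0 : ℝ) ≤ n)])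
  rw [Complex.norm_exp, Real.rpow_def_of_pos (by positivity)]
  refine Real.exp_le_exp.2 ?_
  push_cast
  simp only [neg_re, mul_re, ofReal_re, ofReal_im, mul_zero, sub_zero]
  nlinarith

/-- The contour functionals of the Dirichlet series with coefficients `conj v` pair `v` with the
samples of the exponential sum. -/
lemma contourFunctional_lSeries {c : ℂ} {r : ℝ} {s : Multiset ℂ} (hr : 0 < r) (hrc : r < c.re)
    (hs : ∀ a ∈ s, a ∈ Metric.ball c r) (q : Polynomial ℂ) (v : lp (fun _ : ℕ => ℂ) 2) :
    contourFunctional c r s q (fun z => LSeries (dirichletCoeff v) (z + 1 / 2))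
      = inner ℂ v (sampleMap hr hrc hs q) := by
  have hδ : 0 < c.re - r := sub_pos.2 hrc
  have hsum2 : Summable fun n : ℕ => ‖v n‖ ^ 2 + ((n + 1 : ℕ) : ℝ) ^ (-(1 + 2 * (c.re - r))) :=
    (lp_two_summable v).add ((summable_nat_add_iff 1).2
      (Real.summable_nat_rpow.2 (by linarith)))
  have key := hasSum_contourFunctional hr hs q
    (h := fun n z => ((√((n : ℝ) + 1))⁻¹ : ℝ) * (starRingEnd ℂ) (v n)
      * exp (-(z * Real.log (n + 1))))
    (H := fun z => LSeries (dirichletCoeff v) (z + 1 / 2)) hsum2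
    (fun n => by fun_prop) (fun n z hz => ?_) (fun z hz => ?_)
  · have hinner := lp.hasSum_inner (𝕜 := ℂ) v (sampleMap hr hrc hs q)
    have e : (fun n : ℕ => contourFunctional c r s q fun z => ((√((n : ℝ) + 1))⁻¹ : ℝ)
        * (starRingEnd ℂ) (v n) * exp (-(z * Real.log (n + 1))))
        = fun n : ℕ => inner ℂ (v n) (sampleMap hr hrc hs q n) := by
      funext n
      rw [contourFunctional_const_mul, sampleMap_apply, logSample]
      simp only [RCLike.inner_apply]
      rw [show contourFunctional c r s q (fun z => exp (-(z * Real.log (n + 1))))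
        = expSum c r s q (Real.log (n + 1)) from rfl]
      ring
    rw [e] at key
    exact key.unique hinner
  · have hn : (0 : ℝ) < ((n + 1 : ℕ) : ℝ) := by positivity
    have h1 := norm_exp_neg_mul_log_le (sub_le_re_of_mem_sphere hz) n
    rw [norm_mul, norm_mul, Complex.norm_real, RCLike.norm_conj,
      Real.norm_of_nonneg (by positivity)]
    have e : ((n + 1 : ℕ) : ℝ) ^ (-(1 + 2 * (c.re - r)))
        = ((√((n : ℝ) + 1))⁻¹ * ((n + 1 : ℕ) : ℝ) ^ (-(c.re - r))) ^ 2 := by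
      rw [mul_pow, inv_pow, Real.sq_sqrt (by positivity), ← Real.rpow_natCast (_ ^ _),
        ← Real.rpow_mul hn.le, neg_add, Real.rpow_add hn, Real.rpow_neg_one]
      push_cast
      congr 2; ring
    rw [e]
    set A := (√((n : ℝ) + 1))⁻¹
    have hA : 0 ≤ A := by positivity
    set B := ((n + 1 : ℕ) : ℝ) ^ (-(c.re - r))
    have hB : 0 ≤ B := by positivity
    calc A * ‖v n‖ * _ ≤ A * ‖v n‖ * B := by gcongr
      _ ≤ ‖v n‖ ^ 2 + (A * B) ^ 2 := by
        nlinarith [sq_nonneg (‖v n‖ - A * B), sq_nonneg ‖v n‖, sq_nonneg (A * B)]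
  · have hre : 0 < z.re := re_pos_of_mem_ball hrc (Metric.sphere_subset_closedBall hz)
    have hS : LSeriesSummable (dirichletCoeff v) (z + 1 / 2) :=
      lSeriesSummable_of_summable_sq (summable_dirichletCoeff_sq v) (by simp; linarith)
    have := hS.LSeriesHasSum
    unfold LSeriesHasSum at this
    rw [← hasSum_nat_add_iff' 1] at this
    simpa only [term_dirichletCoeff, Finset.range_one, Finset.sum_singleton, LSeries.term_zero,
      sub_zero] using this

/-! ### Compactness: one Dirichlet series for all finite subsets -/

/-- A finite subset of the open right half-plane lies in a disc whose closure stays inside. -/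
lemma exists_ball_subset_re_pos (s : Multiset ℂ) (hs : ∀ a ∈ s, 0 < a.re) :
    ∃ (c : ℂ) (r : ℝ), 0 < r ∧ r < c.re ∧ ∀ a ∈ s, a ∈ Metric.ball c r := by
  have hone : ∀ a : ℂ, 0 < a.re → ∀ᶠ R : ℝ in Filter.atTop,
      -- The condition |a - R|² < (R - 1/R)² reads |a|² - 2R Re a < -2 + 1/R², which holds once R >
      -- (|a|² + 2)/(2 Re a).
      a ∈ Metric.ball (R : ℂ) (R - 1 / R) := by
    intro a ha
    filter_upwards [Filter.eventually_gt_atTop 1,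
      Filter.eventually_gt_atTop ((‖a‖ ^ 2 + 2) / (2 * a.re))] with R h1 h2
    have hR : 0 < R := by linarith
    have hinv : 1 / R < 1 := by rw [div_lt_one hR]; exact h1
    rw [div_lt_iff₀ (by positivity)] at h2
    rw [Metric.mem_ball, dist_eq_norm]
    refine lt_of_pow_lt_pow_left₀ 2 (by linarith) ?_
    have e : (R - 1 / R) ^ 2 = R ^ 2 - 2 + (1 / R) ^ 2 := by field_simp; ring
    rw [e]
    rw [← Complex.normSq_eq_norm_sq, Complex.normSq_apply] at h2 ⊢
    simp only [sub_re, ofReal_re, sub_im, ofReal_im, sub_zero]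
    nlinarith [sq_nonneg (1 / R)]
  have hall : ∀ᶠ R : ℝ in Filter.atTop, ∀ a ∈ s, a ∈ Metric.ball (R : ℂ) (R - 1 / R) := by
    have := (Filter.eventually_all_finset (l := Filter.atTop)
      (p := fun a (R : ℝ) => a ∈ Metric.ball (R : ℂ) (R - 1 / R)) s.toFinset).2
      fun a ha => hone a (hs a (Multiset.mem_toFinset.1 ha))
    filter_upwards [this] with R hR a ha using hR a (Multiset.mem_toFinset.2 ha)
  obtain ⟨R, hR, hR1⟩ := (hall.and (Filter.eventually_gt_atTop 1)).exists
  have hR0 : 0 < R := by linarith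
  have hinv : 1 / R < 1 := by rw [div_lt_one hR0]; exact hR1
  have hinv0 : 0 < 1 / R := by positivity
  exact ⟨R, R - 1 / R, by linarith, by simpa using hR0, hR⟩

lemma eval_rootPoly_map {ι : Type*} (a : ι → ℂ) (s : Finset ι) (z : ℂ) :
    (rootPoly (s.val.map a)).eval z = ∏ j ∈ s, (z - a j) := by
  rw [eval_rootPoly, Multiset.map_map]; rfl

lemma reSum_map_le {ι : Type*} {a : ι → ℂ} (ha : ∀ j, 0 < (a j).re)
    (hsum : Summable fun j => (a j).re) (s : Finset ι) :
    reSum (s.val.map a) ≤ 2 * ∑' j, (a j).re := by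
  rw [reSum, Multiset.map_map]
  change ∑ j ∈ s, 2 * (a j).re ≤ _
  rw [← Finset.mul_sum]
  have := hsum.sum_le_tsum s fun j _ => (ha j).le
  linarith

/-- A function of the Hardy space agrees with one Dirichlet series on all finite parts of a
bounded sequence of points with summable real parts. -/
theorem exists_dirichlet_interpolant {ι : Type*} {a : ι → ℂ} (ha : ∀ j, 0 < (a j).re)
    (hbdd : ∃ M, ∀ j, ‖a j‖ ≤ M) (hsum : Summable fun j => (a j).re) {f : ℂ → ℂ} {A : ℝ≥0∞}
    (hA : A ≠ ∞) (hf : DifferentiableOn ℂ f {z | 0 < z.re})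
    (hfA : ∀ σ : ℝ, 0 < σ → ∫⁻ t : ℝ, ‖f (σ + t * I)‖ₑ ^ 2 ≤ A) :
    ∃ v : lp (fun _ : ℕ => ℂ) 2, ∀ s : Finset ι, ∃ g : ℂ → ℂ,
      DifferentiableOn ℂ g {z | 0 < z.re} ∧ ∀ z ∈ {z : ℂ | 0 < z.re},
        f z - LSeries (dirichletCoeff v) (z + 1 / 2) = (∏ j ∈ s, (z - a j)) * g z := by
  classical
  obtain ⟨M₀, hM₀⟩ := hbdd
  set M := max M₀ 0
  have hM : ∀ j, ‖a j‖ ≤ M := fun j => (hM₀ j).trans (le_max_left _ _)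
  have hM0 : 0 ≤ M := le_max_right _ _
  have hX0 : 0 ≤ 2 * ∑' j, (a j).re := by
    have : 0 ≤ ∑' j, (a j).re := tsum_nonneg fun j => (ha j).le
    positivity
  obtain ⟨C₁, hC₁, hframe⟩ := exists_expSumNormSq_le (M + 2 * ∑' j, (a j).re) (by positivity)
  -- The product of the Hardy space bound and the frame constant, independent of the finite set;
  -- hence all solutions may be sought in one ball.
  set C := √(A.toReal / (2 * Real.pi) * C₁) with hC
  have hpi := Real.pi_pos
  have hdisc : ∀ s : Finset ι, ∃ (c : ℂ) (r : ℝ), 0 < r ∧ r < c.re ∧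
      ∀ b ∈ s.val.map a, b ∈ Metric.ball c r := fun s =>
    exists_ball_subset_re_pos _ fun b hb => by
      obtain ⟨j, _, rfl⟩ := Multiset.mem_map.1 hb
      exact ha j
  choose c r hr hrc hs using hdisc
  have hfs : ∀ s, ContinuousOn f (Metric.sphere (c s) (r s)) := fun s =>
    hf.continuousOn.mono (Metric.sphere_subset_closedBall.trans (closedBall_subset_re_pos (hrc s)))
  set D : lp (fun _ : ℕ => ℂ) 2 → ℂ → ℂ := fun v z => LSeries (dirichletCoeff v) (z + 1 / 2) with hD
  have hDd : ∀ v, DifferentiableOn ℂ (D v) {z | 0 < z.re} := fun v =>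
    (differentiableOn_lSeries_of_summable_sq (summable_dirichletCoeff_sq v)).comp (by fun_prop)
      fun z (hz : 0 < z.re) => show (1 : ℝ) / 2 < (z + 1 / 2).re by simp; linarith
  set toVec : WeakDual ℂ (lp (fun _ : ℕ => ℂ) 2) → lp (fun _ : ℕ => ℂ) 2 := fun φ =>
    (InnerProductSpace.toDual ℂ _).symm (WeakDual.toStrongDual φ) with htoVec
  have hpair : ∀ φ s q, contourFunctional (c s) (r s) (s.val.map a) q (D (toVec φ))
      = φ (sampleMap (hr s) (hrc s) (hs s) q) := fun φ s q => by
    rw [hD]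
    simp only
    rw [contourFunctional_lSeries (hr s) (hrc s) (hs s), htoVec]
    exact InnerProductSpace.toDual_symm_apply
  -- The contours vary with `s`, but the conditions are equivalent to divisibility, which does not
  -- mention them. This makes the conditions for different finite sets comparable.
  have hdvd : ∀ φ s, (∀ q, φ (sampleMap (hr s) (hrc s) (hs s) q)
      = contourFunctional (c s) (r s) (s.val.map a) q f) ↔ ∃ g : ℂ → ℂ,
      DifferentiableOn ℂ g {z | 0 < z.re} ∧ ∀ z ∈ {z : ℂ | 0 < z.re},
        f z - D (toVec φ) z = (∏ j ∈ s, (z - a j)) * g z := by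
    intro φ s
    have hDs : ContinuousOn (D (toVec φ)) (Metric.sphere (c s) (r s)) :=
      (hDd _).continuousOn.mono
        (Metric.sphere_subset_closedBall.trans (closedBall_subset_re_pos (hrc s)))
    have hDneg : ContinuousOn (fun z => -1 * D (toVec φ) z) (Metric.sphere (c s) (r s)) :=
      continuousOn_const.mul hDs
    have hsub : ∀ q, contourFunctional (c s) (r s) (s.val.map a) q
        (fun z => f z - D (toVec φ) z) = contourFunctional (c s) (r s) (s.val.map a) q f
          - φ (sampleMap (hr s) (hrc s) (hs s) q) := by
      intro q
      have h := contourFunctional_add_right (hr s) (hs s) q (hfs s)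
        hDneg
      rw [contourFunctional_const_mul, hpair] at h
      rw [show (fun z => f z - D (toVec φ) z) = fun z => f z + -1 * D (toVec φ) z from
        funext fun z => by ring, h]
      ring
    constructor
    · intro h
      obtain ⟨g, hg, hgz⟩ := exists_eq_rootPoly_mul isOpen_re_pos (hr s) (hs s)
        (closedBall_subset_re_pos (hrc s)) (hf.sub (hDd (toVec φ)))
        (fun q => (hsub q).trans (by rw [h q, sub_self]))
      exact ⟨g, hg, fun z hz => by rw [← eval_rootPoly_map]; exact hgz z hz⟩
    · rintro ⟨g, hg, hgz⟩ q
      have := contourFunctional_eq_zero_of_dvd (hr s) (hs s) q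
        (h := fun z => f z - D (toVec φ) z) (g := g)
        (diffContOnCl_ball_of_differentiableOn (hrc s) hg) fun z hz => by
          rw [eval_rootPoly_map]
          exact hgz z (closedBall_subset_re_pos (hrc s) (Metric.sphere_subset_closedBall hz))
      rw [hsub, sub_eq_zero] at this
      exact this.symm
  set Z : Finset ι → Set (WeakDual ℂ (lp (fun _ : ℕ => ℂ) 2)) := fun s =>
    (WeakDual.toStrongDual ⁻¹' Metric.closedBall 0 C) ∩
      {φ | ∀ q, φ (sampleMap (hr s) (hrc s) (hs s) q)
        = contourFunctional (c s) (r s) (s.val.map a) q f} with hZ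
  have hclosed : ∀ s, IsClosed {φ : WeakDual ℂ (lp (fun _ : ℕ => ℂ) 2) |
      ∀ q, φ (sampleMap (hr s) (hrc s) (hs s) q)
        = contourFunctional (c s) (r s) (s.val.map a) q f} := fun s => by
    simp only [Set.ofPred_forall]
    exact isClosed_iInter fun q => isClosed_eq (WeakDual.eval_continuous _) continuous_const
  have hcomp : ∀ s, IsCompact (Z s) := fun s =>
    (WeakDual.isCompact_closedBall 0 C).inter_right (hclosed s)
  have hne : ∀ s, (Z s).Nonempty := by
    intro s
    obtain ⟨φ, hφ, hφq⟩ := exists_dual_comp_eq (sampleMap (hr s) (hrc s) (hs s))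
      (contourLinearMap (hr s) (hs s) (hfs s)) (Real.sqrt_nonneg _ : 0 ≤ C) fun q => by
        have h1 := norm_contourFunctional_sq_le_of_hardy hA hf hfA (hr s) (hrc s) (hs s) q
        have h2 := hframe (c s) (r s) (s.val.map a) M (hr s) (hrc s) (hs s) hM0
          (fun b hb => by
            obtain ⟨j, _, rfl⟩ := Multiset.mem_map.1 hb
            exact hM j)
          (by linarith [reSum_map_le ha hsum s]) q
        refine le_of_sq_le_sq ?_ (by positivity)
        rw [mul_pow, Real.sq_sqrt (by positivity)]
        calc _ ≤ _ := h1
          _ ≤ A.toReal / (2 * Real.pi) *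
              (C₁ * ‖sampleMap (hr s) (hrc s) (hs s) q‖ ^ 2) := by gcongr
          _ = _ := by ring
    refine ⟨WeakDual.toStrongDual.symm φ, ?_, fun q => hφq q⟩
    simpa using hφ
  have hmono : ∀ s t : Finset ι, s ⊆ t → Z t ⊆ Z s := by
    rintro s t hst φ ⟨h1, h2⟩
    refine ⟨h1, ?_⟩
    obtain ⟨g, hg, hgz⟩ := (hdvd φ t).1 h2
    refine (hdvd φ s).2 ⟨fun z => (∏ j ∈ t \ s, (z - a j)) * g z, ?_, fun z hz => ?_⟩
    · exact DifferentiableOn.mul (Differentiable.differentiableOn (by fun_prop)) hg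
    · rw [hgz z hz, ← Finset.prod_sdiff hst]; ring
  -- The sets `Z s` are weak-* compact by Banach-Alaoglu, nonempty by Hahn-Banach, and directed
  -- under unions of finite sets.
  obtain ⟨φ, hφ⟩ := IsCompact.nonempty_iInter_of_directed_nonempty_isCompact_isClosed Z
    (fun s t => ⟨s ∪ t, hmono _ _ Finset.subset_union_left, hmono _ _ Finset.subset_union_right⟩)
    hne hcomp fun s => (hcomp s).isClosed
  refine ⟨toVec φ, fun s => ?_⟩
  exact (hdvd φ s).1 (Set.mem_iInter.1 hφ s).2

/-! ### Division by the infinite Blaschke product -/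

lemma isOpen_halfPlane : IsOpen halfPlane := isOpen_lt continuous_const Complex.continuous_re

lemma re_sub_half_le_norm_sub_reflection {w s : ℂ} (hw : w ∈ halfPlane) :
    s.re - 1 / 2 ≤ ‖s - (1 - (starRingEnd ℂ) w)‖ := by
  have hw' : (1 : ℝ) / 2 < w.re := hw
  refine le_trans ?_ (Complex.re_le_norm _)
  simp
  linarith

lemma sub_reflection_ne_zero {w s : ℂ} (hw : w ∈ halfPlane) (hs : s ∈ halfPlane) :
    s - (1 - (starRingEnd ℂ) w) ≠ 0 :=
  norm_pos_iff.1 ((sub_pos.2 hs).trans_le (re_sub_half_le_norm_sub_reflection hw))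

lemma norm_blaschkeFactor_sub_one_le {w s : ℂ} (hw : w ∈ halfPlane) {δ : ℝ} (hδ : 0 < δ)
    (hs : δ ≤ s.re - 1 / 2) : ‖blaschkeFactor w s - 1‖ ≤ 2 / δ * (w.re - 1 / 2) := by
  have hw' : (0 : ℝ) < w.re - 1 / 2 := sub_pos.2 hw
  have hle := hs.trans (re_sub_half_le_norm_sub_reflection (s := s) hw)
  have hnum : (s - w) - (s - (1 - (starRingEnd ℂ) w)) = ((-(2 * (w.re - 1 / 2)) : ℝ) : ℂ) := by
    apply Complex.ext <;> simp
    ring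
  rw [blaschkeFactor, div_sub_one (norm_pos_iff.1 (hδ.trans_le hle)), hnum, norm_div,
    Complex.norm_real, norm_neg, Real.norm_of_nonneg (by positivity)]
  calc 2 * (w.re - 1 / 2) / ‖s - (1 - (starRingEnd ℂ) w)‖
      ≤ 2 * (w.re - 1 / 2) / δ := by gcongr
    _ = _ := by ring

lemma differentiableOn_blaschkeFactor {w : ℂ} (hw : w ∈ halfPlane) :
    DifferentiableOn ℂ (blaschkeFactor w) halfPlane :=
  DifferentiableOn.div (by fun_prop) (by fun_prop) fun _ hs => sub_reflection_ne_zero hw hs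

lemma blaschkeFactor_ne_zero {w s : ℂ} (hw : w ∈ halfPlane) (hs : s ∈ halfPlane) (h : w ≠ s) :
    blaschkeFactor w s ≠ 0 :=
  div_ne_zero (sub_ne_zero.2 h.symm) (sub_reflection_ne_zero hw hs)

section

variable {ι : Type*} {S : ι → ℂ}

open Classical in
/-- The Blaschke product with the factors of index in `t` left out. -/
noncomputable def blaschkeTail (S : ι → ℂ) (t : Finset ι) (s : ℂ) : ℂ :=
  ∏' j, (1 + if j ∈ t then 0 else blaschkeFactor (S j) s - 1)

lemma IsBoundedBlaschke.re_nonneg (hS : IsBoundedBlaschke S) (j : ι) : 0 ≤ (S j).re - 1 / 2 :=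
  (sub_pos.2 (hS.mem j)).le

open Classical in
lemma norm_tail_le (hS : IsBoundedBlaschke S) (t : Finset ι) {δ : ℝ} (hδ : 0 < δ) {s : ℂ}
    (hs : δ ≤ s.re - 1 / 2) (j : ι) :
    ‖if j ∈ t then 0 else blaschkeFactor (S j) s - 1‖ ≤ 2 / δ * ((S j).re - 1 / 2) := by
  split_ifs
  · have := hS.re_nonneg j
    rw [norm_zero]
    positivity
  · exact norm_blaschkeFactor_sub_one_le (hS.mem j) hδ hs

open Classical in
lemma summable_norm_tail (hS : IsBoundedBlaschke S) (t : Finset ι) {s : ℂ} (hs : s ∈ halfPlane) :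
    Summable fun j => ‖if j ∈ t then 0 else blaschkeFactor (S j) s - 1‖ :=
  Summable.of_nonneg_of_le (fun _ => norm_nonneg _)
    (fun j => norm_tail_le hS t (sub_pos.2 hs) le_rfl j) (hS.summable.mul_left _)

/-- An absolutely convergent product vanishes only if one of its factors does, and the factors
vanishing at `s` have been replaced by 1. -/
lemma blaschkeTail_ne_zero (hS : IsBoundedBlaschke S) {t : Finset ι} {s : ℂ} (hs : s ∈ halfPlane)
    (ht : ∀ j, S j = s → j ∈ t) : blaschkeTail S t s ≠ 0 := by
  classical
  refine tprod_one_add_ne_zero_of_summable (fun j => ?_) (summable_norm_tail hS t hs)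
  split_ifs with h
  · simp
  · rw [add_sub_cancel]
    exact blaschkeFactor_ne_zero (hS.mem j) hs fun hj => h (ht j hj)

lemma blaschkeProduct_eq_prod_mul_tail (hS : IsBoundedBlaschke S) (t : Finset ι) {s : ℂ}
    (hs : s ∈ halfPlane) :
    blaschkeProduct S s = (∏ j ∈ t, blaschkeFactor (S j) s) * blaschkeTail S t s := by
  classical
  have h1 : HasProd (fun j => if j ∈ t then blaschkeFactor (S j) s else 1)
      (∏ j ∈ t, blaschkeFactor (S j) s) := by
    have h := hasProd_prod_of_ne_finset_one (L := SummationFilter.unconditional ι)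
      (f := fun j => if j ∈ t then blaschkeFactor (S j) s else 1) (s := t)
      fun j hj => by simp [hj]
    rwa [Finset.prod_congr rfl fun j hj => by rw [if_pos hj]] at h
  have h2 := (multipliable_one_add_of_summable (summable_norm_tail hS t hs)).hasProd
  refine Eq.trans ?_ (h1.mul h2).tprod_eq
  rw [blaschkeProduct]
  refine tprod_congr fun j => ?_
  split_ifs <;> simp

lemma differentiableOn_blaschkeTail (hS : IsBoundedBlaschke S) (t : Finset ι) :
    DifferentiableOn ℂ (blaschkeTail S t) halfPlane := by
  classical
  intro w hw
  have hw' : (0 : ℝ) < w.re - 1 / 2 := sub_pos.2 hw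
  -- At distance δ from the boundary line the factors have the uniform summable majorant of
  -- `norm_tail_le`, so the product converges locally uniformly.
  set δ := (w.re - 1 / 2) / 2 with hδ
  have hδ0 : 0 < δ := by positivity
  set U : Set ℂ := {s | δ + 1 / 2 < s.re}
  have hU : IsOpen U := isOpen_lt continuous_const Complex.continuous_re
  have hUh : U ⊆ halfPlane := fun s (hs : δ + 1 / 2 < s.re) =>
    show (1 : ℝ) / 2 < s.re by linarith
  have hd : ∀ j, DifferentiableOn ℂ (fun s => if j ∈ t then 0 else blaschkeFactor (S j) s - 1) U := by
    intro j
    split_ifs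
    · exact differentiableOn_const _
    · exact ((differentiableOn_blaschkeFactor (hS.mem j)).mono hUh).sub_const 1
  have hprod := (hS.summable.mul_left (2 / δ)).hasProdLocallyUniformlyOn_one_add
    (f := fun j s => if j ∈ t then 0 else blaschkeFactor (S j) s - 1) hU
    (.of_forall fun j s (hs : δ + 1 / 2 < s.re) =>
      norm_tail_le hS t hδ0 (by linarith) j) fun j => (hd j).continuousOn
  have : DifferentiableOn ℂ (blaschkeTail S t) U :=
    hprod.differentiableOn (.of_forall fun u => by
      simpa [Finset.prod_fn] using
        DifferentiableOn.finsetProd (u := u) fun j _ => (hd j).const_add 1) hU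
  exact (this.differentiableAt (hU.mem_nhds (show δ + 1 / 2 < w.re by linarith))).differentiableWithinAt

/-- The terms of a convergent series tend to 0, so the zeros can accumulate only at the boundary
line. -/
lemma finite_setOf_le_re (hS : IsBoundedBlaschke S) {δ : ℝ} (hδ : 0 < δ) :
    {j | δ ≤ (S j).re - 1 / 2}.Finite := by
  have h := hS.summable.tendsto_cofinite_zero.eventually (gt_mem_nhds hδ)
  simpa [Filter.eventually_cofinite] using h

lemma finite_setOf_eq (hS : IsBoundedBlaschke S) {w : ℂ} (hw : w ∈ halfPlane) :
    {j | S j = w}.Finite :=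
  (finite_setOf_le_re hS (sub_pos.2 hw)).subset fun j (hj : S j = w) => by simp [hj]

/-- The zeros of a Blaschke sequence are isolated in the half-plane. -/
lemma eventually_ne_or_eq (hS : IsBoundedBlaschke S) {w : ℂ} (hw : w ∈ halfPlane) :
    ∀ᶠ z in nhds w, ∀ j, S j = z → S j = w := by
  have hw' : (0 : ℝ) < w.re - 1 / 2 := sub_pos.2 hw
  set δ := (w.re - 1 / 2) / 2 with hδ
  have hfin := finite_setOf_le_re hS (show 0 < δ by positivity)
  have h1 : ∀ᶠ z in nhds w, ∀ j ∈ {j | δ ≤ (S j).re - 1 / 2}, S j = z → S j = w := by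
    rw [Filter.eventually_all_finite hfin]
    intro j _
    by_cases hj : S j = w
    · exact .of_forall fun _ _ => hj
    · filter_upwards [isOpen_ne.mem_nhds (Ne.symm hj)] with z hz h
      exact absurd h.symm hz
  have h2 : ∀ᶠ z : ℂ in nhds w, δ + 1 / 2 < z.re :=
    (isOpen_lt continuous_const Complex.continuous_re).mem_nhds (by simp [hδ]; linarith)
  filter_upwards [h1, h2] with z hz hz2 j hj
  exact hz j (by simp only [hj]; linarith) hj

/-- A holomorphic function that every finite partial product of the zeros divides is divisible
by the Blaschke product. -/
theorem dividesOnHalfPlane_blaschkeProduct (hS : IsBoundedBlaschke S) {H : ℂ → ℂ}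
    (h : ∀ t : Finset ι, ∃ g : ℂ → ℂ, DifferentiableOn ℂ g halfPlane ∧
      ∀ z ∈ halfPlane, H z = (∏ j ∈ t, (z - S j)) * g z) :
    DividesOnHalfPlane (blaschkeProduct S) H := by
  classical
  choose g hg hgz using h
  set D : Finset ι → ℂ → ℂ := fun t z => ∏ j ∈ t, (z - (1 - (starRingEnd ℂ) (S j)))
  have hD0 : ∀ t, ∀ z ∈ halfPlane, D t z ≠ 0 := fun t z hz =>
    Finset.prod_ne_zero_iff.2 fun j _ => sub_reflection_ne_zero (hS.mem j) hz
  set G : Finset ι → ℂ → ℂ := fun t z => g t z * D t z / blaschkeTail S t z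
  have hG : ∀ t, ∀ z ∈ halfPlane, (∀ j, S j = z → j ∈ t) → H z = blaschkeProduct S z * G t z := by
    intro t z hz ht
    have h1 := blaschkeTail_ne_zero hS hz ht
    have h2 := hD0 t z hz
    have h3 : ∏ j ∈ t, blaschkeFactor (S j) z = (∏ j ∈ t, (z - S j)) / D t z :=
      Finset.prod_div_distrib _ _
    rw [blaschkeProduct_eq_prod_mul_tail hS t hz, hgz t z hz, h3]
    simp only [G]
    field_simp
  -- At each point only the factors vanishing there are taken out of the product. In the half-plane
  -- there are finitely many; the default ∅ is never reached there.
  set τ : ℂ → Finset ι := fun z => if hz : {j | S j = z}.Finite then hz.toFinset else ∅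
  have hτ : ∀ z ∈ halfPlane, ∀ j, j ∈ τ z ↔ S j = z := fun z hz j => by
    simp [τ, dif_pos (finite_setOf_eq hS hz)]
  refine ⟨fun z => G (τ z) z, fun w hw => ?_, fun z hz => hG _ z hz fun j => (hτ z hz j).2⟩
  have hT0 : blaschkeTail S (τ w) w ≠ 0 := blaschkeTail_ne_zero hS hw fun j => (hτ w hw j).2
  have hwn := isOpen_halfPlane.mem_nhds hw
  have hGd : DifferentiableAt ℂ (G (τ w)) w := by
    refine DifferentiableAt.div (DifferentiableAt.mul ((hg _).differentiableAt hwn) ?_)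
      ((differentiableOn_blaschkeTail hS _).differentiableAt hwn) hT0
    exact Differentiable.differentiableAt (by fun_prop)
  refine (hGd.congr_of_eventuallyEq ?_).differentiableWithinAt
  filter_upwards [eventually_ne_or_eq hS hw, hwn] with z hz hzh
  by_cases hzw : z = w
  · rw [hzw]
  · have hno : ∀ j, S j ≠ z := fun j hj => hzw (hj.symm.trans (hz j hj))
    have hB : blaschkeProduct S z ≠ 0 := by
      rw [blaschkeProduct_eq_prod_mul_tail hS ∅ hzh, Finset.prod_empty, one_mul]
      exact blaschkeTail_ne_zero hS hzh fun j hj => absurd hj (hno j)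
    -- Near `w`, other than at `w`, the Blaschke product is nonzero, so every admissible `G t` has
    -- the same value H/B; the pointwise choice therefore coincides with the single function `G (τ
    -- w)`.
    refine mul_left_cancel₀ hB ?_
    rw [← hG _ z hzh fun j hj => absurd hj (hno j), ← hG _ z hzh fun j hj => absurd hj (hno j)]

end

theorem theorem1 {ι : Type*} [Countable ι] (S : ι → ℂ) (hS : IsBoundedBlaschke S)
    (f : ℂ → ℂ) (hf : MemHardy2 f) :
    ∃ F : ℂ → ℂ, MemDirichletH2 F ∧
      DividesOnHalfPlane (blaschkeProduct S) (fun s => f s - F s) := by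
  obtain ⟨M, hM⟩ := hS.bounded.exists_norm_le
  have hshift : ∀ z ∈ halfPlane, z - 1 / 2 ∈ {z : ℂ | 0 < z.re} := fun z hz => by
    have : (1 : ℝ) / 2 < z.re := hz
    simpa using this
  -- Translation by 1/2 turns the Blaschke condition into summability of the real parts.
  obtain ⟨v, hv⟩ := exists_dirichlet_interpolant (a := fun j => S j - 1 / 2)
    (f := fun z => f (z + 1 / 2)) (A := hardyNormSq f) (fun j => hshift _ (hS.mem j))
    ⟨M + ‖(1 / 2 : ℂ)‖, fun j => (norm_sub_le _ _).trans (by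
      gcongr
      exact hM _ ⟨j, rfl⟩)⟩
    (by simpa using hS.summable) hf.2.ne
    (hf.1.comp (by fun_prop) fun z (hz : 0 < z.re) =>
      show (1 : ℝ) / 2 < (z + 1 / 2).re by simp; linarith)
    fun σ hσ => by
      refine le_trans (le_of_eq ?_) (le_iSup₂_of_le (σ + 1 / 2) (by linarith) le_rfl)
      congr 1 with t
      congr 3
      push_cast
      ring_nf
  refine ⟨LSeries (dirichletCoeff v), ⟨dirichletCoeff v, summable_dirichletCoeff_sq v, fun s hs =>
    (lSeriesSummable_of_summable_sq (summable_dirichletCoeff_sq v) hs).LSeriesHasSum⟩, ?_⟩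
  refine dividesOnHalfPlane_blaschkeProduct hS fun t => ?_
  obtain ⟨g, hg, hgz⟩ := hv t
  refine ⟨fun z => g (z - 1 / 2), hg.comp (by fun_prop) hshift, fun z hz => ?_⟩
  simpa using hgz _ (hshift z hz)
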